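/- Consider $n$ buyers arriving one by one in a fixed order and $m$ items with multipliers $\alpha_1\ge\alpha_2\ge\dots\ge\alpha_m\ge 0$. The types $v_1,\dots,v_n\ge 0$ of the buyers are independent draws from one continuous distribution on $[0,\infty)$, with cumulative distribution function $F$ and probability density function $f$, that has a monotone hazard rate: $x\mapsto f(x)/(1-F(x))$ is non-decreasing on $\{x: F(x)<1\}$. Valuations are separable and unit-demand: the value of buyer $i$ for item $j$ is $\alpha_j v_i$, and every buyer receives at most one item. Put $\alpha'_k=\alpha_k$ if $k\le\min\{m,\,n-n^{5/6}\}$ and $\alpha'_k=0$ for all other $k$, and let $$q_k=\min\Big\{\tfrac{k}{n}\,2\log\log n,\ \tfrac{k}{n}+\sqrt{\tfrac{\log n}{n}}\Big\}.$$ Consider the posted-prices mechanism with the static prices $$p_j=\sum_{k=j}^{n}(\alpha'_k-\alpha'_{k+1})\,F^{-1}(1-q_k)\quad\text{for } j\le n-n^{5/6},\qquad p_j=\infty\quad\text{for } j>n-n^{5/6},$$ so that the items $j>n-n^{5/6}$ are discarded. Each arriving buyer $i$ buys, among the items not yet sold, one that maximizes her utility $\alpha_jv_i-p_j$ if this maximum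 is positive, and buys nothing if the utilities of all unsold items are negative; ties, and the decision at maximum utility zero, may be resolved arbitrarily. Let $\mathrm{SW}_{\mathrm{pp}}$ be the social welfare (sum over the matched buyers $i$ of $\alpha_{j_i}v_i$, where $j_i$ is the item bought by $i$) of the resulting matching, and let $\mathrm{SW}_{\mathrm{opt}}$ be the maximum social welfare of any matching of buyers and items. Then the mechanism is $\big(1-O\big(\frac{\log\log\log n}{\log n}\big)\big)$-competitive for social welfare: there are absolute constants $C>0$ and $N$ such that for all $n\ge N$, all $m$, all multipliers and all distributions as above, both expectations are finite and $$\mathbb E[\mathrm{SW}_{\mathrm{pp}}]\ \ge\ \Big(1-C\,\frac{\log\log\log n}{\log n}\Big)\,\mathbb E[\mathrm{SW}_{\mathrm{opt}}].$$ -/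

import Mathlib

open MeasureTheory ProbabilityTheory

namespace PostedPrice

noncomputable section

/-- A continuous distribution on the non-negative reals with monotone hazard rate: `μ` has a
probability density function `f` such that the hazard rate `f x / (1 - F x)` is non-decreasing on
the set of all `x` with `F x < 1`, where `F` is the cumulative distribution function of `μ`. -/
structure IsMHR (μ : Measure ℝ) : Prop where
  nonneg : ∀ᵐ x ∂μ, 0 ≤ x
  monotone_hazard : ∃ f : ℝ → ℝ, Measurable f ∧ (∀ x, 0 ≤ f x) ∧
    μ = volume.withDensity (fun x => ENNReal.ofReal (f x)) ∧
    MonotoneOn (fun x => f x / (1 - cdf μ x)) {x | cdf μ x < 1}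

/-- The quantile function `F⁻¹` of the distribution `μ`. -/
def quantile (μ : Measure ℝ) (p : ℝ) : ℝ := sInf {x : ℝ | p ≤ cdf μ x}

/-! ### Allocations, welfare and posted prices for unit-demand buyers

There are `n` buyers, arriving in the order `0, 1, …, n - 1`, and `m` items; `v i j` is the value of
buyer `i` for item `j`. An allocation maps each buyer to an item, or to `none` (unmatched). -/

/-- No item is assigned to two different buyers. -/
def IsMatching {n m : ℕ} (a : Fin n → Option (Fin m)) : Prop :=
  ∀ i i' j, a i = some j → a i' = some j → i = i'

/-- The social welfare of an allocation. -/
def welfare {n m : ℕ} (v : Fin n → Fin m → ℝ) (a : Fin n → Option (Fin m)) : ℝ :=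
  ∑ i, (a i).elim 0 (v i)

/-- The optimal (offline) social welfare: the maximum over the finitely many matchings. -/
def optWelfare {n m : ℕ} (v : Fin n → Fin m → ℝ) : ℝ :=
  ⨆ a : {a : Fin n → Option (Fin m) // IsMatching a}, welfare v a.1

/-- Item `j` has not been bought by a buyer who arrives before buyer `i`. -/
def Available {n m : ℕ} (a : Fin n → Option (Fin m)) (i : Fin n) (j : Fin m) : Prop :=
  ∀ i', i' < i → a i' ≠ some j

/-- The utility of buyer `i` for buying item `j` at price `p j`. It is `⊥` if the price is `⊤`. -/
def utility {n m : ℕ} (v : Fin n → Fin m → ℝ) (p : Fin m → EReal) (i : Fin n) (j : Fin m) :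
    EReal :=
  (v i j : EReal) - p j

/-- `a` is a possible outcome of the posted-prices mechanism with static prices `p`: buyers arrive
one by one, and each buys an available item of maximum utility if that utility is positive and
nothing if all available items have negative utility. Ties between items of equal utility, and
between buying at utility zero and not buying, may be broken in any way. -/
structure IsOutcome {n m : ℕ} (v : Fin n → Fin m → ℝ) (p : Fin m → EReal)
    (a : Fin n → Option (Fin m)) : Prop where
  of_some : ∀ i j, a i = some j → Available a i j ∧ 0 ≤ utility v p i j ∧
    ∀ k, Available a i k → utility v p i k ≤ utility v p i j
  of_none : ∀ i, a i = none → ∀ k, Available a i k → utility v p i k ≤ 0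

/-! ### Separable valuations and the quantile-based static prices -/

/-- Separable valuations: the value of buyer `i` for item `j` is the multiplier `α j` of the item
times the type `t i` of the buyer. -/
def separableValue {n m : ℕ} (α : Fin m → ℝ) (t : Fin n → ℝ) (i : Fin n) (j : Fin m) : ℝ :=
  α j * t i

/-- The item with number `k` (counted from one) is kept if `k ≤ n - n ^ (5 / 6)`. -/
def Kept (n k : ℕ) : Prop := (k : ℝ) ≤ (n : ℝ) - (n : ℝ) ^ (5 / 6 : ℝ)

open Classical in
/-- The truncated multipliers, with items numbered from one: the multiplier of item number `k` if
there is such an item and it is kept, and zero otherwise. -/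
def truncMult (n : ℕ) {m : ℕ} (α : Fin m → ℝ) (k : ℕ) : ℝ :=
  if h : 1 ≤ k ∧ k ≤ m ∧ Kept n k then α ⟨k - 1, by omega⟩ else 0

/-- The probabilities `q_k = min {(k / n) * 2 log log n, k / n + √(log n / n)}`. -/
def saleProb (n k : ℕ) : ℝ :=
  min ((k : ℝ) / n * (2 * Real.log (Real.log n))) ((k : ℝ) / n + √(Real.log n / n))

open Classical in
/-- The static prices. The item `j : Fin m` has number `j + 1`. Its price is `∞` if it is not kept,
and otherwise `∑_{k = j + 1}^n (α'_k - α'_{k + 1}) F⁻¹(1 - q_k)`, where `α'` are the truncated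
multipliers. -/
def staticPrice (n : ℕ) {m : ℕ} (μ : Measure ℝ) (α : Fin m → ℝ) (j : Fin m) : EReal :=
  if Kept n (j + 1) then
    ((∑ k ∈ Finset.Icc ((j : ℕ) + 1) n,
      (truncMult n α k - truncMult n α (k + 1)) * quantile μ (1 - saleProb n k) : ℝ) : EReal)
  else ⊤

end

end PostedPrice

/-!
The welfare of an outcome is the revenue plus the utilities of the buyers. With `c k` for the drop
`α'_k - α'_{k+1}` of the truncated multipliers (`multDrop`), `x k = F⁻¹(1 - q_k)` for the breakpoints
(`breakpoint`) and `R y = E[max (v - y) 0]` for the mean excess of a type (`meanExcess`), item `j`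
gives a buyer of type `v` the utility `∑_{k ≥ j} c k * (v - x k)` (`itemUtil`), so that a buyer with
`v > x k` prefers the last item of a class of equal multipliers ending at `k` to all later items.
All bounds are linear combinations with the weights `c k`, and it suffices to compare, for each `k`,
the coefficients.

*Optimum.* Every matching gives at most `k` buyers one of the first `k` items, so for any threshold
`y k ≥ 0` the coefficient is at most `k * y k + n * R (y k)`, up to the factor `1 / (1 - δ)`, where
`δ = 1 / log n`, lost by discarding the last items (`optWelfare_le`, `integral_optWelfare_le`).

*Revenue.* An item `j` whose class of equal multipliers ends at `l` is sold as soon as `l` buyers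
have a type above `x l` (`IsSale.exists_eq`). This has probability at least `1 - δ`
(`IsLarge.measureReal_unsold_le`): Markov's inequality for `(1 / 2) ^ count` handles the first of
the two expressions in the definition of `q_l`, Hoeffding's inequality the second. The
revenue thus contributes `(1 - δ) * k * x k`.

*Utility.* As long as at most `(1 - δ) * n` buyers have arrived, with high probability no window of
about `n ^ (3 / 4)` items is sold out: a maximal sold-out interval has been bought up by buyers with
types between the breakpoints at its two ends, and there are too few of those
(`IsSale.exists_available`, `IsLarge.card_lt_of_mem_regularBefore`). A buyer then loses little
compared with her favourite item (`IsSale.windowUtil_le`), and the utility contributes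
`n * R (x k)` up to a factor `(1 - δ) ^ 3` if `k ≥ n ^ (7 / 8)`. For such `k` the choice `y k = x k`
finishes the comparison (`IsLarge.le_revenue_add_utility`), whatever the distribution.

For `k < n ^ (7 / 8)` the revenue suffices (`IsLarge.exists_le_revenue`). This is where the hazard
rate enters: it makes `(1 - F x) ^ (1 / x)` antitone (`IsMHR.survival_le_exp`), hence bounds `R` by
an exponential integral. With `y k` chosen as the point at which the exponential bound equals
`k / n`, the ratio of `k * x k` and `k * y k + n * R (y k)` is at least
`log (1 / q_k) / (1 + log (n / k))`, which is `1 - O(log log log n / log n)` since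
`q_k ≤ 2 * (k / n) * log log n` and `log (n / k) ≥ log n / 8`.

The tie-breaking is arbitrary and need not be measurable in the types. For almost all types no buyer
is indifferent between items of different multipliers, and then all outcomes give the same
multipliers to the same buyers (`IsSale.itemMult_eq`), so the welfare is almost everywhere
measurable (`aestronglyMeasurable_welfare`).
-/

namespace PostedPrice

/-! ### Quantiles of distributions without atoms -/

section Quantile

variable {μ : Measure ℝ} [IsProbabilityMeasure μ]

lemma one_sub_cdf (x : ℝ) : 1 - cdf μ x = μ.real (Set.Ioi x) := by
  rw [cdf_eq_real, ← Set.compl_Iic, probReal_compl_eq_one_sub measurableSet_Iic]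

lemma continuous_cdf [NullSingletonClass μ] : Continuous (cdf μ) := by
  refine continuous_iff_continuousAt.2 fun x => ?_
  rw [(monotone_cdf μ).continuousAt_iff_leftLim_eq_rightLim, (cdf μ).rightLim_eq]
  have h := (cdf μ).measure_singleton x
  rw [measure_cdf, measure_singleton] at h
  have h1 : cdf μ x - Function.leftLim (cdf μ) x ≤ 0 := ENNReal.ofReal_eq_zero.1 h.symm
  exact le_antisymm ((monotone_cdf μ).leftLim_le le_rfl) (by linarith)

lemma bddBelow_le_cdf {μ : Measure ℝ} {p : ℝ} (hp : 0 < p) : BddBelow {x : ℝ | p ≤ cdf μ x} := by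
  obtain ⟨b, hb⟩ := ((tendsto_cdf_atBot μ).eventually_lt_const hp).exists
  exact ⟨b, fun x hx => le_of_not_gt fun h =>
    absurd (hx.trans (monotone_cdf μ h.le)) (not_le.2 hb)⟩

lemma nonempty_le_cdf {μ : Measure ℝ} {p : ℝ} (hp : p < 1) : {x : ℝ | p ≤ cdf μ x}.Nonempty :=
  (((tendsto_cdf_atTop μ).eventually_const_lt hp).exists).imp fun _ h => h.le

lemma cdf_quantile [NullSingletonClass μ] {p : ℝ} (h0 : 0 < p) (h1 : p < 1) :
    cdf μ (quantile μ p) = p := by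
  refine le_antisymm ?_ ?_
  · have : p ∈ Set.range (cdf μ) :=
      mem_range_of_exists_le_of_exists_ge continuous_cdf
        ((((tendsto_cdf_atBot μ).eventually_lt_const h0).exists).imp fun _ h => h.le)
        (nonempty_le_cdf h1)
    obtain ⟨x, hx⟩ := this
    exact (monotone_cdf μ (csInf_le (bddBelow_le_cdf h0) hx.ge)).trans hx.le
  · exact (isClosed_le continuous_const continuous_cdf).csInf_mem (nonempty_le_cdf h1)
      (bddBelow_le_cdf h0)

lemma quantile_mono {μ : Measure ℝ} {p q : ℝ} (h0 : 0 < p) (hpq : p ≤ q) (h1 : q < 1) :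
    quantile μ p ≤ quantile μ q :=
  csInf_le_csInf (bddBelow_le_cdf h0) (nonempty_le_cdf h1) fun _ hx => hpq.trans hx

lemma measureReal_Ioi_quantile [NullSingletonClass μ] {q : ℝ} (h0 : 0 < q) (h1 : q < 1) :
    μ.real (Set.Ioi (quantile μ (1 - q))) = q := by
  rw [← one_sub_cdf, cdf_quantile (by linarith) (by linarith)]; ring

lemma measureReal_Ioi_zero (h : ∀ᵐ x ∂μ, 0 ≤ x) [NullSingletonClass μ] :
    μ.real (Set.Ioi (0 : ℝ)) = 1 := by
  have h0 : ∀ᵐ x ∂μ, x ≠ 0 := by simp [ae_iff]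
  have : μ (Set.Ioi (0 : ℝ)) = 1 := by
    rw [← measure_univ (μ := μ)]
    refine measure_congr ?_
    filter_upwards [h, h0] with x hx hx0
    exact eq_iff_iff.2 ⟨fun _ => trivial, fun _ => lt_of_le_of_ne hx hx0.symm⟩
  simp [Measure.real, this]

lemma quantile_pos (h : ∀ᵐ x ∂μ, 0 ≤ x) [NullSingletonClass μ] {p : ℝ} (h0 : 0 < p) (h1 : p < 1) :
    0 < quantile μ p := by
  by_contra! hq
  have := monotone_cdf μ hq
  rw [cdf_quantile h0 h1] at this
  have := measureReal_Ioi_zero h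
  rw [← one_sub_cdf] at this
  linarith

end Quantile

/-! ### Exponential tails from a monotone hazard rate -/

section HazardRate

variable {μ : Measure ℝ} [IsProbabilityMeasure μ]

lemma IsMHR.nullSingletonClass {μ : Measure ℝ} (h : IsMHR μ) : NullSingletonClass μ := by
  obtain ⟨f, -, -, hf, -⟩ := h.monotone_hazard
  rw [hf]; infer_instance

/-- Backward Grönwall estimate with constant rate. -/
lemma mul_exp_le_of_add_integral_le {G : ℝ → ℝ} (hG : Continuous G) {c x y : ℝ} (hc : 0 ≤ c)
    (hxy : x ≤ y) (h : ∀ z ∈ Set.Icc x y, G y + c * ∫ s in z..y, G s ≤ G z) :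
    G y * Real.exp (c * (y - x)) ≤ G x := by
  set Φ : ℝ → ℝ := fun z => (G y + c * ∫ s in z..y, G s) * Real.exp (c * (z - y)) with hΦ
  have hI : ∀ z, HasDerivAt (fun z => ∫ s in z..y, G s) (-G z) z := fun z =>
    intervalIntegral.integral_hasDerivAt_left (hG.intervalIntegrable _ _)
      hG.stronglyMeasurable.stronglyMeasurableAtFilter hG.continuousAt
  have hd : ∀ z, HasDerivAt Φ ((c * -G z) * Real.exp (c * (z - y)) +
      (G y + c * ∫ s in z..y, G s) * (Real.exp (c * (z - y)) * (c * 1))) z := fun z =>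
    (((hI z).const_mul c).const_add (G y)).mul
      ((((hasDerivAt_id z).sub_const y).const_mul c).exp)
  have hanti : AntitoneOn Φ (Set.Icc x y) := by
    refine antitoneOn_of_deriv_nonpos (convex_Icc x y)
      (fun z _ => (hd z).continuousAt.continuousWithinAt)
      (fun z _ => (hd z).differentiableAt.differentiableWithinAt) fun z hz => ?_
    rw [(hd z).deriv]
    have h1 := h z (interior_subset hz)
    have : c * Real.exp (c * (z - y)) * (G y + (c * ∫ s in z..y, G s) - G z) ≤ 0 :=
      mul_nonpos_of_nonneg_of_nonpos (by positivity) (by linarith)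
    linarith
  have h1 := hanti ⟨le_rfl, hxy⟩ ⟨hxy, le_rfl⟩ hxy
  simp only [hΦ, intervalIntegral.integral_same, mul_zero, add_zero, sub_self, Real.exp_zero,
    mul_one] at h1
  have h2 := h1.trans (mul_le_mul_of_nonneg_right (h x ⟨le_rfl, hxy⟩) (Real.exp_nonneg _))
  calc G y * Real.exp (c * (y - x)) ≤ G x * Real.exp (c * (x - y)) * Real.exp (c * (y - x)) := by
        gcongr
    _ = G x := by rw [mul_assoc, ← Real.exp_add]; ring_nf; simp

/-- Backward Grönwall estimate with constant rate, in the other direction. -/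
lemma le_mul_exp_of_le_add_integral {G : ℝ → ℝ} (hG : Continuous G) {c x y : ℝ} (hc : 0 ≤ c)
    (hxy : x ≤ y) (h : ∀ z ∈ Set.Icc x y, G z ≤ G y + c * ∫ s in z..y, G s) :
    G x ≤ G y * Real.exp (c * (y - x)) := by
  have := mul_exp_le_of_add_integral_le (G := fun z => -G z) hG.neg hc hxy fun z hz => by
    have := h z hz
    simp only [intervalIntegral.integral_neg]
    linarith
  linarith

/-- With a monotone hazard rate the survival function `G` satisfies `G y ^ (1 / y) ≤ G x ^ (1 / x)`
for `0 < x ≤ y`: if `c` is the hazard rate at `x`, then `1 ≤ G x * exp (c * x)` because the hazard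
rate is at most `c` before `x`, and `G y ≤ G x * exp (-c * (y - x))` because it is at least `c`
after `x`. -/
lemma IsMHR.survival_le_exp (h : IsMHR μ) {x y : ℝ} (hx : 0 < x) (hxy : x ≤ y)
    (hpos : 0 < μ.real (Set.Ioi x)) :
    μ.real (Set.Ioi y) ≤ Real.exp (-(-Real.log (μ.real (Set.Ioi x)) / x) * y) := by
  have := h.nullSingletonClass
  set G : ℝ → ℝ := fun z => μ.real (Set.Ioi z) with hGdef
  have hGc : Continuous G := by
    simp only [hGdef, ← one_sub_cdf]; exact continuous_const.sub continuous_cdf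
  obtain hy | hy := (measureReal_nonneg (μ := μ) (s := Set.Ioi y)).eq_or_lt
  · rw [← hy]; positivity
  obtain ⟨f, hfm, hf0, hμ, hmono⟩ := h.monotone_hazard
  have hfi : Integrable f := by
    refine ⟨hfm.aestronglyMeasurable, ?_⟩
    rw [hasFiniteIntegral_iff_ofReal (ae_of_all _ hf0)]
    have : μ Set.univ = 1 := measure_univ
    rw [hμ, withDensity_apply _ MeasurableSet.univ, Measure.restrict_univ] at this
    rw [this]; simp
  have hdiff : ∀ a b, a ≤ b → G a - G b = ∫ s in a..b, f s := by
    intro a b hab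
    have h1 : G a = G b + μ.real (Set.Ioc a b) := by
      simp only [hGdef]
      rw [← Set.Ioc_union_Ioi_eq_Ioi hab,
        measureReal_union (Set.Ioc_disjoint_Ioi le_rfl) measurableSet_Ioi, add_comm]
    have h2 : μ.real (Set.Ioc a b) = ∫ s in a..b, f s := by
      rw [intervalIntegral.integral_of_le hab, Measure.real]
      conv_lhs => rw [hμ]
      rw [withDensity_apply _ measurableSet_Ioc,
        integral_eq_lintegral_of_nonneg_ae (ae_of_all _ hf0) hfm.aestronglyMeasurable]
    linarith
  have hlt : ∀ z, z ≤ y → 0 < G z := fun z hz =>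
    hy.trans_le (measureReal_mono (Set.Ioi_subset_Ioi hz))
  have hmem : ∀ z, z ≤ y → z ∈ {x | cdf μ x < 1} := fun z hz => by
    have := hlt z hz
    simp only [hGdef, ← one_sub_cdf] at this
    simpa using this
  have hmono' : ∀ a b, a ≤ b → b ≤ y → f a / G a ≤ f b / G b := fun a b hab hb => by
    have := hmono (hmem a (hab.trans hb)) (hmem b hb) hab
    simpa only [one_sub_cdf] using this
  set c := f x / G x with hcdef
  have hc : 0 ≤ c := div_nonneg (hf0 x) measureReal_nonneg
  -- the hazard rate is at most `c` on `[0, x]`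
  have hleft : G 0 ≤ G x * Real.exp (c * (x - 0)) := by
    refine le_mul_exp_of_le_add_integral hGc hc hx.le fun z hz => ?_
    have := hdiff z x hz.2
    have hle : ∫ s in z..x, f s ≤ ∫ s in z..x, c * G s := by
      refine intervalIntegral.integral_mono_on hz.2 hfi.intervalIntegrable
        ((hGc.const_mul c).intervalIntegrable _ _) fun s hs => ?_
      exact (div_le_iff₀ (hlt s (hs.2.trans hxy))).1 (hmono' s x hs.2 hxy)
    rw [intervalIntegral.integral_const_mul] at hle
    linarith
  -- the hazard rate is at least `c` on `[x, y]`
  have hright : G y * Real.exp (c * (y - x)) ≤ G x := by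
    refine mul_exp_le_of_add_integral_le hGc hc hxy fun z hz => ?_
    have := hdiff z y hz.2
    have hle : ∫ s in z..y, c * G s ≤ ∫ s in z..y, f s := by
      refine intervalIntegral.integral_mono_on hz.2 ((hGc.const_mul c).intervalIntegrable _ _)
        hfi.intervalIntegrable fun s hs => ?_
      exact (le_div_iff₀ (hlt s hs.2)).1 (hmono' x s (hz.1.trans hs.1) hs.2)
    rw [intervalIntegral.integral_const_mul] at hle
    linarith
  have hG0 : G 0 = 1 := measureReal_Ioi_zero h.nonneg
  rw [hG0, sub_zero] at hleft
  have hlogx : -(c * x) ≤ Real.log (G x) := by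
    rw [Real.le_log_iff_exp_le hpos, Real.exp_neg, inv_le_iff_one_le_mul₀ (Real.exp_pos _)]
    exact hleft
  have hlogy : Real.log (G y) ≤ Real.log (G x) - c * (y - x) := by
    have := Real.log_le_log (by positivity) hright
    rw [Real.log_mul hy.ne' (Real.exp_ne_zero _), Real.log_exp] at this
    linarith
  change G y ≤ _
  rw [← Real.log_le_iff_le_exp hy]
  refine hlogy.trans ?_
  have key : Real.log (G x) - c * (y - x) ≤ Real.log (G x) + Real.log (G x) / x * (y - x) := by
    have h1 : -c ≤ Real.log (G x) / x := by rw [le_div_iff₀ hx]; linarith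
    nlinarith [mul_le_mul_of_nonneg_right h1 (sub_nonneg.2 hxy)]
  refine key.trans (le_of_eq ?_)
  field_simp
  ring

end HazardRate

/-! ### The mean excess -/

section MeanExcess

/-- The unnormalised mean excess `E[max (X - y) 0]` of a random variable `X` with law `μ`. -/
noncomputable def meanExcess (μ : Measure ℝ) (y : ℝ) : ℝ := ∫ t, max (t - y) 0 ∂μ

/-- The expectation of `X - x` on the event `z < X`, for a random variable `X` with law `μ`. -/
noncomputable def truncExcess (μ : Measure ℝ) (x z : ℝ) : ℝ :=
  ∫ t, (Set.Ioi z).indicator (fun t => t - x) t ∂μ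

variable {μ : Measure ℝ} [IsProbabilityMeasure μ]

lemma lintegral_excess_le {l y : ℝ} (hl : 0 < l)
    (h : ∀ z, y ≤ z → μ.real (Set.Ioi z) ≤ Real.exp (-l * z)) :
    ∫⁻ t, ENNReal.ofReal (max (t - y) 0) ∂μ ≤ ENNReal.ofReal (Real.exp (-l * y) / l) := by
  rw [lintegral_eq_lintegral_meas_lt μ (ae_of_all _ fun t => le_max_right (t - y) 0)
    (by fun_prop)]
  have hint : IntegrableOn (fun s => Real.exp (-l * y) * Real.exp (-l * s)) (Set.Ioi 0) :=
    (integrableOn_exp_mul_Ioi (neg_lt_zero.2 hl) 0).const_mul _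
  calc ∫⁻ s in Set.Ioi (0 : ℝ), μ {a | s < max (a - y) 0}
      ≤ ∫⁻ s in Set.Ioi (0 : ℝ), ENNReal.ofReal (Real.exp (-l * y) * Real.exp (-l * s)) := by
        refine setLIntegral_mono (by fun_prop) fun s hs => ?_
        have : {a : ℝ | s < max (a - y) 0} ⊆ Set.Ioi (y + s) := fun a ha => by
          simp only [Set.mem_ofPred_eq, lt_max_iff, Set.mem_Ioi] at ha hs ⊢
          rcases ha with ha | ha <;> linarith
        refine (measure_mono this).trans ?_
        rw [← ofReal_measureReal (measure_ne_top _ _), ← Real.exp_add, ← mul_add]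
        exact ENNReal.ofReal_le_ofReal (h _ (by linarith [Set.mem_Ioi.1 hs]))
    _ = ENNReal.ofReal (∫ s in Set.Ioi (0 : ℝ), Real.exp (-l * y) * Real.exp (-l * s)) :=
        (ofReal_integral_eq_lintegral_ofReal hint (ae_of_all _ fun s => by positivity)).symm
    _ = _ := by
        rw [integral_const_mul, integral_exp_mul_Ioi (neg_lt_zero.2 hl)]
        simp [div_eq_mul_inv]

lemma IsMHR.lintegral_excess_le (hμ : IsMHR μ) {x y : ℝ} (hx : 0 < x) (hxy : x ≤ y)
    (h0 : 0 < μ.real (Set.Ioi x)) (h1 : μ.real (Set.Ioi x) < 1) :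
    ∫⁻ t, ENNReal.ofReal (max (t - y) 0) ∂μ ≤
      ENNReal.ofReal (Real.exp (-(-Real.log (μ.real (Set.Ioi x)) / x) * y) /
        (-Real.log (μ.real (Set.Ioi x)) / x)) :=
  PostedPrice.lintegral_excess_le (div_pos (neg_pos.2 (Real.log_neg h0 h1)) hx) fun _ hz =>
    hμ.survival_le_exp hx (hxy.trans hz) h0

lemma IsMHR.integrable_id (hμ : IsMHR μ) : Integrable (fun t => t) μ := by
  have := hμ.nullSingletonClass
  set x := quantile μ (1 - 1 / 2)
  have hx : 0 < x := quantile_pos hμ.nonneg (by norm_num) (by norm_num)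
  have hG : μ.real (Set.Ioi x) = 1 / 2 := measureReal_Ioi_quantile (by norm_num) (by norm_num)
  have h := hμ.lintegral_excess_le hx le_rfl (by rw [hG]; norm_num) (by rw [hG]; norm_num)
  have hi : Integrable (fun t => max (t - x) 0) μ := by
    refine ⟨by fun_prop, ?_⟩
    rw [hasFiniteIntegral_iff_ofReal (ae_of_all _ fun t => le_max_right (t - x) 0)]
    exact h.trans_lt ENNReal.ofReal_lt_top
  refine (hi.add (integrable_const x)).mono' (by fun_prop) ?_
  filter_upwards [hμ.nonneg] with t ht
  rw [Real.norm_of_nonneg ht]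
  have := le_max_left (t - x) 0
  simp only [Pi.add_apply]
  linarith

lemma integrable_excess (hi : Integrable (fun t => t) μ) (y : ℝ) :
    Integrable (fun t => max (t - y) 0) μ :=
  (hi.sub (integrable_const y)).pos_part

lemma meanExcess_nonneg {μ : Measure ℝ} (y : ℝ) : 0 ≤ meanExcess μ y :=
  integral_nonneg fun _ => le_max_right _ _

lemma IsMHR.meanExcess_le (hμ : IsMHR μ) {x y : ℝ} (hx : 0 < x) (hxy : x ≤ y)
    (h0 : 0 < μ.real (Set.Ioi x)) (h1 : μ.real (Set.Ioi x) < 1) :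
    meanExcess μ y ≤ Real.exp (-(-Real.log (μ.real (Set.Ioi x)) / x) * y) /
        (-Real.log (μ.real (Set.Ioi x)) / x) := by
  have hl : 0 < -Real.log (μ.real (Set.Ioi x)) / x :=
    div_pos (neg_pos.2 (Real.log_neg h0 h1)) hx
  rw [meanExcess, integral_eq_lintegral_of_nonneg_ae
    (ae_of_all _ fun t => le_max_right (t - y) 0)
    (by fun_prop)]
  exact ENNReal.toReal_le_of_le_ofReal (by positivity) (hμ.lintegral_excess_le hx hxy h0 h1)

lemma integrable_truncExcess (hi : Integrable (fun t => t) μ) (x z : ℝ) :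
    Integrable ((Set.Ioi z).indicator fun t => t - x) μ :=
  (hi.sub (integrable_const x)).indicator measurableSet_Ioi

/-- Raising the cutoff of the excess over `x` from `x` to `z` loses at most the factor by which the
probability of exceeding the cutoff drops: the part lost is at most `z - x` on an event of
probability `G x - G z`, the part kept is at least `z - x` on an event of probability `G z`. -/
lemma meanExcess_mul_le_truncExcess_mul (hi : Integrable (fun t => t) μ) {x z : ℝ} (hxz : x ≤ z) :
    meanExcess μ x * μ.real (Set.Ioi z) ≤ truncExcess μ x z * μ.real (Set.Ioi x) := by
  set A := truncExcess μ x z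
  have hconst : ∀ s : Set ℝ, MeasurableSet s →
      Integrable (s.indicator fun _ => z - x) μ ∧
        ∫ t, s.indicator (fun _ => z - x) t ∂μ = μ.real s * (z - x) := fun s hs =>
    ⟨(integrable_const _).indicator hs, by rw [integral_indicator_const _ hs, smul_eq_mul]⟩
  have hA : μ.real (Set.Ioi z) * (z - x) ≤ A := by
    rw [← (hconst _ measurableSet_Ioi).2]
    refine integral_mono (hconst _ measurableSet_Ioi).1 (integrable_truncExcess hi x z) fun t => ?_
    refine Set.indicator_le_indicator' fun ht => ?_
    simp only [Set.mem_Ioi] at ht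
    linarith
  have hB : meanExcess μ x - A ≤ μ.real (Set.Ioc x z) * (z - x) := by
    simp only [A, truncExcess]
    rw [meanExcess, ← integral_sub (integrable_excess hi x) (integrable_truncExcess hi x z),
      ← (hconst _ measurableSet_Ioc).2]
    refine integral_mono ((integrable_excess hi x).sub (integrable_truncExcess hi x z))
      (hconst _ measurableSet_Ioc).1 fun t => ?_
    simp only [Set.indicator_apply, Set.mem_Ioi, Set.mem_Ioc]
    rcases le_or_gt t x with h | h
    · rw [max_eq_right (by linarith), if_neg (by linarith), if_neg (by simp [h])]; simp
    · rw [max_eq_left (by linarith)]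
      by_cases h' : z < t
      · rw [if_pos h', if_neg (by simp [h'])]; simp
      · rw [if_neg h', if_pos ⟨h, not_lt.1 h'⟩]; linarith [not_lt.1 h']
  have hsplit : μ.real (Set.Ioi x) = μ.real (Set.Ioc x z) + μ.real (Set.Ioi z) := by
    rw [← Set.Ioc_union_Ioi_eq_Ioi hxz,
      measureReal_union (Set.Ioc_disjoint_Ioi le_rfl) measurableSet_Ioi]
  have h1 := mul_le_mul_of_nonneg_left hA (measureReal_nonneg (μ := μ) (s := Set.Ioc x z))
  have h2 := mul_le_mul_of_nonneg_right hB (measureReal_nonneg (μ := μ) (s := Set.Ioi z))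
  rw [hsplit]
  nlinarith

/-- With `r = k / n`, the term `r * y + meanExcess μ y` bounds `1 / n` times the expected sum of the
`k` largest of `n` types. It is compared with the revenue from selling `k` items at a price `x` whose
sale probability `q` exceeds `r` by a factor of at most `exp l`. -/
lemma IsMHR.exists_le_mul (hμ : IsMHR μ) {x q r l : ℝ} (hx : 0 < x)
    (hG : μ.real (Set.Ioi x) = q) (hq0 : 0 < q) (hq1 : q < 1) (hr0 : 0 < r) (hrq : r ≤ q)
    (hl : Real.log q ≤ Real.log r + l) :
    ∃ y, 0 ≤ y ∧
      (-Real.log r - l) * (r * y + meanExcess μ y) ≤ (1 - Real.log r) * (r * x) := by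
  have hlogq : Real.log q < 0 := Real.log_neg hq0 hq1
  have hlogr : Real.log r ≤ Real.log q := Real.log_le_log hr0 hrq
  -- the bound of `survival_le_exp` on the survival function equals `r` at `y`
  set y := x * (-Real.log r) / (-Real.log q) with hy
  have hxy : x ≤ y := by
    rw [hy, le_div_iff₀ (by linarith)]
    exact mul_le_mul_of_nonneg_left (by linarith) hx.le
  have h := hμ.meanExcess_le hx hxy (by rw [hG]; exact hq0) (by rw [hG]; exact hq1)
  rw [hG] at h
  have h1 : -(-Real.log q / x) * y = Real.log r := by
    have := hlogq.ne
    rw [hy]; field_simp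
  rw [h1, Real.exp_log hr0] at h
  refine ⟨y, by linarith, ?_⟩
  have hsum : r * y + meanExcess μ y ≤ (1 - Real.log r) * (r * x) / (-Real.log q) := by
    calc r * y + meanExcess μ y ≤ r * y + r / (-Real.log q / x) := by linarith
      _ = _ := by rw [hy]; field_simp; ring
  have h0 : 0 ≤ r * y + meanExcess μ y :=
    add_nonneg (mul_nonneg hr0.le (by linarith)) (meanExcess_nonneg y)
  calc (-Real.log r - l) * (r * y + meanExcess μ y)
      ≤ (-Real.log q) * (r * y + meanExcess μ y) := by gcongr; linarith
    _ ≤ (-Real.log q) * ((1 - Real.log r) * (r * x) / (-Real.log q)) := by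
        gcongr; linarith
    _ = _ := by rw [mul_div_cancel₀]; linarith

end MeanExcess

/-! ### Sequential sales of numbered items -/

section ItemNumbers

/-- The multiplier of item number `j` when the increments of the multipliers are `c`; the number
`0` stands for receiving no item. -/
noncomputable def itemMult (c : ℕ → ℝ) (M j : ℕ) : ℝ :=
  if j = 0 then 0 else ∑ k ∈ Finset.Ico j (M + 1), c k

/-- The price of item number `j` built from increments `c` and breakpoints `x`; receiving no item
is free. -/
noncomputable def itemPrice (c x : ℕ → ℝ) (M j : ℕ) : ℝ :=
  if j = 0 then 0 else ∑ k ∈ Finset.Ico j (M + 1), c k * x k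

/-- The utility of a buyer of type `v` for item number `j`. -/
noncomputable def itemUtil (c x : ℕ → ℝ) (M j : ℕ) (v : ℝ) : ℝ :=
  if j = 0 then 0 else ∑ k ∈ Finset.Ico j (M + 1), c k * (v - x k)

/-- A sequential sale of the items `1, …, M`: buyer `i` of type `t i` receives item `o i`, a best
one among those that are left and the option `0` of receiving nothing. -/
structure IsSale {n : ℕ} (c x : ℕ → ℝ) (M : ℕ) (t : Fin n → ℝ) (o : Fin n → ℕ) : Prop where
  le : ∀ i, o i ≤ M
  inj : ∀ i i', o i ≠ 0 → o i = o i' → i = i'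
  best : ∀ i l, l ≤ M → (l = 0 ∨ ∀ i' < i, o i' ≠ l) →
    itemUtil c x M l (t i) ≤ itemUtil c x M (o i) (t i)

variable {c x : ℕ → ℝ} {M : ℕ}

@[simp] lemma itemUtil_zero (v : ℝ) : itemUtil c x M 0 v = 0 := if_pos rfl
@[simp] lemma itemMult_zero : itemMult c M 0 = 0 := if_pos rfl
@[simp] lemma itemPrice_zero : itemPrice c x M 0 = 0 := if_pos rfl

lemma itemUtil_last (v : ℝ) : itemUtil c x M (M + 1) v = 0 := by simp [itemUtil]

lemma itemMult_mul (j : ℕ) (v : ℝ) :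
    itemMult c M j * v = itemPrice c x M j + itemUtil c x M j v := by
  unfold itemMult itemPrice itemUtil
  split_ifs
  · simp
  · rw [Finset.sum_mul, ← Finset.sum_add_distrib]
    exact Finset.sum_congr rfl fun k _ => by ring

lemma itemPrice_nonneg (hc : ∀ k, 1 ≤ k → 0 ≤ c k) (hx0 : ∀ k, 1 ≤ k → k ≤ M → 0 ≤ x k) (j : ℕ) :
    0 ≤ itemPrice c x M j := by
  unfold itemPrice
  split_ifs with h
  · rfl
  · refine Finset.sum_nonneg fun k hk => ?_
    rw [Finset.mem_Ico] at hk
    exact mul_nonneg (hc k (by omega)) (hx0 k (by omega) (by omega))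

lemma itemUtil_split {j l : ℕ} (hj : 1 ≤ j) (hjl : j ≤ l) (hl : l ≤ M + 1) (v : ℝ) :
    itemUtil c x M j v = ∑ k ∈ Finset.Ico j l, c k * (v - x k) + itemUtil c x M l v := by
  rw [itemUtil, itemUtil, if_neg (by omega), if_neg (by omega),
    Finset.sum_Ico_consecutive _ hjl hl]

lemma itemUtil_congr {j l : ℕ} (hj : 1 ≤ j) (hjl : j ≤ l) (hl : l ≤ M + 1)
    (h0 : ∀ r, j ≤ r → r < l → c r = 0) (v : ℝ) : itemUtil c x M j v = itemUtil c x M l v := by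
  rw [itemUtil_split hj hjl hl, Finset.sum_eq_zero, zero_add]
  intro k hk
  rw [Finset.mem_Ico] at hk
  rw [h0 k hk.1 hk.2, zero_mul]

lemma itemUtil_eq_of_itemMult_eq (hc : ∀ k, 1 ≤ k → 0 ≤ c k) {j l : ℕ} (hj : j ≤ M) (hl : l ≤ M)
    (h : itemMult c M j = itemMult c M l) (v : ℝ) : itemUtil c x M j v = itemUtil c x M l v := by
  wlog hjl : j ≤ l generalizing j l
  · exact (this hl hj h.symm (by omega)).symm
  obtain rfl | hj0 := Nat.eq_zero_or_pos j
  · obtain rfl | hl0 := Nat.eq_zero_or_pos l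
    · rfl
    rw [itemMult_zero, itemMult, if_neg (by omega), eq_comm, Finset.sum_eq_zero_iff_of_nonneg] at h
    · rw [itemUtil_zero, itemUtil_congr (l := M + 1) hl0 (by omega) le_rfl, itemUtil_last]
      exact fun r h1 h2 => h r (Finset.mem_Ico.2 ⟨h1, h2⟩)
    · exact fun k hk => hc k (by rw [Finset.mem_Ico] at hk; omega)
  · rw [itemMult, itemMult, if_neg (by omega), if_neg (by omega),
      ← Finset.sum_Ico_consecutive _ hjl (by omega : l ≤ M + 1), add_eq_right,
      Finset.sum_eq_zero_iff_of_nonneg] at h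
    · exact itemUtil_congr hj0 hjl (by omega) (fun r h1 h2 => h r (Finset.mem_Ico.2 ⟨h1, h2⟩)) v
    · exact fun k hk => hc k (by rw [Finset.mem_Ico] at hk; omega)

/-- A buyer whose type exceeds the breakpoint `x l` prefers the last items up to `l` to all later
ones. -/
lemma itemUtil_lt_of_gt (hc : ∀ k, 1 ≤ k → 0 ≤ c k)
    (hx : ∀ k l, 1 ≤ k → k ≤ l → l ≤ M → x l ≤ x k) {j l z : ℕ} (hj : 1 ≤ j) (hjl : j ≤ l)
    (hlz : l < z) (hz : z ≤ M + 1) (h0 : ∀ r, j ≤ r → r < l → c r = 0) (hcl : 0 < c l) {v : ℝ}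
    (hv : x l < v) : itemUtil c x M z v < itemUtil c x M j v := by
  rw [itemUtil_congr hj hjl (by omega) h0, itemUtil_split (by omega) hlz.le hz]
  refine lt_add_of_pos_left _ (Finset.sum_pos' (fun k hk => ?_) ⟨l, ?_, ?_⟩)
  · rw [Finset.mem_Ico] at hk
    exact mul_nonneg (hc k (by omega))
      (by have := hx l k (by omega) hk.1 (by omega); linarith)
  · exact Finset.mem_Ico.2 ⟨le_rfl, hlz⟩
  · exact mul_pos hcl (by linarith)

/-- A buyer whose type is below the breakpoint `x b` prefers the first items after `b` to all
earlier ones. -/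
lemma itemUtil_lt_of_lt (hc : ∀ k, 1 ≤ k → 0 ≤ c k)
    (hx : ∀ k l, 1 ≤ k → k ≤ l → l ≤ M → x l ≤ x k) {l b z : ℕ} (hl : 1 ≤ l) (hlb : l ≤ b)
    (hbz : b < z) (hz : z ≤ M + 1) (h0 : ∀ r, b < r → r < z → c r = 0) (hcb : 0 < c b) {v : ℝ}
    (hv : v < x b) : itemUtil c x M l v < itemUtil c x M z v := by
  rw [itemUtil_split hl (by omega : l ≤ b + 1) (by omega),
    itemUtil_congr (by omega : 1 ≤ b + 1) hbz hz fun r h1 h2 => h0 r h1 h2]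
  refine add_lt_of_neg_left _ (Finset.sum_neg' (fun k hk => ?_) ⟨b, ?_, ?_⟩)
  · rw [Finset.mem_Ico] at hk
    exact mul_nonpos_of_nonneg_of_nonpos (hc k (by omega))
      (by have := hx k b (by omega) (by omega) (by omega); linarith)
  · exact Finset.mem_Ico.2 ⟨hlb, by omega⟩
  · exact mul_neg_of_pos_of_neg hcb (by linarith)

variable {n : ℕ} {t : Fin n → ℝ} {o o' : Fin n → ℕ}

/-- An item `j` is sold if at least `l` buyers have a type above `x l`, where `l` is the last item
with the multiplier of `j`: while `j` is unsold, all these buyers buy one of the other items up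
to `l`. -/
lemma IsSale.exists_eq (h : IsSale c x M t o) (hc : ∀ k, 1 ≤ k → 0 ≤ c k)
    (hx : ∀ k l, 1 ≤ k → k ≤ l → l ≤ M → x l ≤ x k) {j l : ℕ} (hj : 1 ≤ j) (hjl : j ≤ l)
    (hl : l ≤ M) (h0 : ∀ r, j ≤ r → r < l → c r = 0) (hcl : 0 < c l)
    (hcard : l ≤ (Finset.univ.filter fun i => x l < t i).card) : ∃ i, o i = j := by
  by_contra! hne
  have hmem : ∀ i, x l < t i → o i ∈ (Finset.Icc 1 l).erase j := fun i hi => by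
    have hbest := h.best i j (by omega) (Or.inr fun i' _ => hne i')
    have hgt := fun z h1 h2 => itemUtil_lt_of_gt (z := z) hc hx hj hjl h1 h2 h0 hcl hi
    have hpos := hgt (M + 1) (by omega) le_rfl
    rw [itemUtil_last] at hpos
    rw [Finset.mem_erase, Finset.mem_Icc]
    refine ⟨hne i, Nat.one_le_iff_ne_zero.2 fun h0 => ?_, not_lt.1 fun hlt => ?_⟩
    · rw [h0, itemUtil_zero] at hbest
      linarith
    · have := hgt (o i) hlt ((h.le i).trans (by omega))
      linarith
  have hle : (Finset.univ.filter fun i => x l < t i).card ≤ ((Finset.Icc 1 l).erase j).card := by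
    refine Finset.card_le_card_of_injOn o (fun i hi => ?_) fun i hi i' _ hii' => ?_
    · exact hmem i (by simpa using hi)
    · have := hmem i (by simpa using hi)
      rw [Finset.mem_erase, Finset.mem_Icc] at this
      exact h.inj i i' (by omega) hii'
  rw [Finset.card_erase_of_mem (Finset.mem_Icc.2 ⟨hj, hjl⟩), Nat.card_Icc] at hle
  omega

/-- If no long interval of types has been hit as often as there are items belonging to it, then no
long window of items is sold out: extend a sold-out window ending at `k` to a maximal sold-out
interval `(s, b]` whose ends separate items of different multipliers; all the buyers of its items
preferred them to unsold items on both sides, so that their types lie between `x b` and `x s`. -/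
lemma IsSale.exists_available (h : IsSale c x M t o) (hc : ∀ k, 1 ≤ k → 0 ≤ c k)
    (hx : ∀ k l, 1 ≤ k → k ≤ l → l ≤ M → x l ≤ x k) {w : ℕ} (hw : 1 ≤ w) {i : Fin n}
    (hgood : ∀ s b, s < b → b ≤ M → w ≤ b - s →
      (Finset.univ.filter fun i' => i' < i ∧ x b ≤ t i' ∧ (s = 0 ∨ t i' ≤ x s)).card < b - s)
    {k : ℕ} (hwk : w < k) (hk : k ≤ M) (hck : 0 < c k) :
    ∃ l, 1 ≤ l ∧ l ≤ k ∧ (∀ i' < i, o i' ≠ l) ∧ ∀ r, l ≤ r → r ≤ k - w → c r = 0 := by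
  classical
  have : Nonempty (Fin n) := ⟨i⟩
  by_contra! H
  have hsold : ∀ l, 1 ≤ l → l ≤ k → (∀ r, l ≤ r → r ≤ k - w → c r = 0) →
      ∃ i' < i, o i' = l := fun l h1 h2 h3 => by
    by_contra! hno
    obtain ⟨r, hr1, hr2, hr3⟩ := H l h1 h2 hno
    exact hr3 (h3 r hr1 hr2)
  have hgreatest : ∀ q, Nat.findGreatest (fun r => 0 < c r) q ≤ q ∧
      (Nat.findGreatest (fun r => 0 < c r) q = 0 ∨
        0 < c (Nat.findGreatest (fun r => 0 < c r) q)) ∧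
      ∀ r, Nat.findGreatest (fun r => 0 < c r) q < r → r ≤ q → c r = 0 := fun q =>
    ⟨Nat.findGreatest_le q, or_iff_not_imp_left.2 fun h0 =>
      Nat.findGreatest_of_ne_zero (P := fun r => 0 < c r) rfl h0, fun r h1 h2 =>
      le_antisymm (not_lt.1 (Nat.findGreatest_is_greatest h1 h2)) (hc r (by omega))⟩
  -- the left end of the sold-out interval
  have hP : ∃ s, s ≤ k - w ∧ (s = 0 ∨ 0 < c s) ∧ ∀ l, s < l → l ≤ k → ∃ i' < i, o i' = l := by
    obtain ⟨h1, h2, h3⟩ := hgreatest (k - w)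
    exact ⟨_, h1, h2, fun l hl hlk => hsold l (by omega) hlk fun r hr hr' =>
      h3 r (by omega) hr'⟩
  obtain ⟨hs1, hs2, hs3⟩ := Nat.find_spec hP
  have hsmin := fun s => Nat.find_min hP (m := s)
  set s := Nat.find hP
  -- the right end of the sold-out interval
  let Q : ℕ → Prop := fun b => k ≤ b ∧ 0 < c b ∧ ∀ l, k < l → l ≤ b → ∃ i' < i, o i' = l
  have hQk : Q k := ⟨le_rfl, hck, fun l h1 h2 => by omega⟩
  obtain ⟨hb1, hb2, hb3⟩ := Nat.findGreatest_spec hk hQk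
  have hbM : Nat.findGreatest Q M ≤ M := Nat.findGreatest_le M
  have hbmax : ∀ b, Nat.findGreatest Q M < b → b ≤ M → ¬ Q b := fun b h1 h2 =>
    Nat.findGreatest_is_greatest h1 h2
  set b := Nat.findGreatest Q M
  have hall : ∀ l ∈ Finset.Ioc s b, ∃ i' < i, o i' = l := fun l hl => by
    rw [Finset.mem_Ioc] at hl
    rcases le_or_gt l k with hlk | hlk
    · exact hs3 l hl.1 hlk
    · exact hb3 l hlk hl.2
  choose! f hfi hfo using hall
  refine absurd (hgood s b (by omega) hbM (by omega)) (not_lt.2 ?_)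
  rw [← Nat.card_Ioc]
  refine Finset.card_le_card_of_injOn f (fun l hl => ?_) fun l hl l' hl' hll' => ?_
  swap
  · rw [← hfo l hl, ← hfo l' hl', hll']
  have hlt := Finset.mem_Ioc.1 hl
  have hlo := hfo l hl
  have hbest : ∀ z, z ≤ M → (∀ i' < i, o i' ≠ z) →
      itemUtil c x M z (t (f l)) ≤ itemUtil c x M l (t (f l)) := fun z hz hz' => by
    have := h.best (f l) z hz (Or.inr fun i' hi' => hz' i' (hi'.trans (hfi l hl)))
    rwa [hlo] at this
  simp only [Finset.coe_filter, Finset.mem_univ, true_and, Set.mem_ofPred_eq]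
  refine ⟨hfi l hl, ?_, ?_⟩
  · by_contra! hv
    by_cases hnext : ∃ b', b < b' ∧ b' ≤ M ∧ 0 < c b'
    · obtain ⟨hn1, hn2, hn3⟩ := Nat.find_spec hnext
      have hnmin := fun r => Nat.find_min hnext (m := r)
      set b' := Nat.find hnext
      have := hbmax b' hn1 hn2
      simp only [Q, not_and, not_forall, not_exists] at this
      obtain ⟨z, hz1, hz2, hz3⟩ := this (by omega) hn3
      have hbz : b < z := by
        by_contra! hzb
        obtain ⟨i', hi', hi''⟩ := hb3 z hz1 hzb
        exact hz3 i' hi' hi''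
      have h1 := hbest z (by omega) hz3
      have h2 := itemUtil_lt_of_lt (z := z) hc hx (by omega) hlt.2 hbz (by omega)
        (fun r hr hr' => le_antisymm (not_lt.1 fun hcr => hnmin r (by omega)
          ⟨hr, by omega, hcr⟩) (hc r (by omega))) hb2 hv
      linarith
    · push Not at hnext
      have h1 := h.best (f l) 0 (by omega) (Or.inl rfl)
      have h2 := itemUtil_lt_of_lt (z := M + 1) hc hx (by omega) hlt.2 (by omega) le_rfl
        (fun r hr hr' => le_antisymm (hnext r hr (by omega)) (hc r (by omega))) hb2 hv
      rw [itemUtil_last] at h2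
      rw [itemUtil_zero, hlo] at h1
      linarith
  · rcases hs2 with hs0 | hcs
    · exact Or.inl hs0
    by_contra! hv
    obtain ⟨hs0, hv⟩ := hv
    obtain ⟨h1, h2, h3⟩ := hgreatest (s - 1)
    have := hsmin _ (by omega : Nat.findGreatest (fun r => 0 < c r) (s - 1) < s)
    simp only [not_and, not_forall, not_exists] at this
    obtain ⟨z, hz1, hz2, hz3⟩ := this (by omega) h2
    have hzs : z ≤ s := by
      by_contra! hsz
      obtain ⟨i', hi', hi''⟩ := hs3 z hsz hz2
      exact hz3 i' hi' hi''
    have h4 := hbest z (by omega) hz3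
    have h5 := itemUtil_lt_of_gt (z := l) hc hx (by omega) hzs hlt.1 (by omega)
      (fun r hr hr' => h3 r (by omega) (by omega)) hcs hv
    linarith

/-- A lower bound on the utility of a buyer of type `v` if no window of `w` consecutive items is
sold out. -/
noncomputable def windowUtil (c x : ℕ → ℝ) (M w : ℕ) (v : ℝ) : ℝ :=
  ∑ k ∈ Finset.Ioc w M, c k * (Set.Ioi (x (k - w))).indicator (fun t => t - x k) v

lemma IsSale.windowUtil_le (h : IsSale c x M t o) (hc : ∀ k, 1 ≤ k → 0 ≤ c k)
    (hx : ∀ k l, 1 ≤ k → k ≤ l → l ≤ M → x l ≤ x k) {w : ℕ} (hw : 1 ≤ w) {i : Fin n}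
    (havail : ∀ k, w < k → k ≤ M → 0 < c k →
      ∃ l, 1 ≤ l ∧ l ≤ k ∧ (∀ i' < i, o i' ≠ l) ∧ ∀ r, l ≤ r → r ≤ k - w → c r = 0) :
    windowUtil c x M w (t i) ≤ itemUtil c x M (o i) (t i) := by
  classical
  set v := t i
  by_cases hex : ∃ k, w < k ∧ k ≤ M ∧ 0 < c k ∧ x (k - w) < v
  · obtain ⟨hk1, hk2, hk3, hk4⟩ := Nat.find_spec hex
    have hmin := fun r => Nat.find_min hex (m := r)
    set k := Nat.find hex
    obtain ⟨l, hl1, hlk, hav, hl0⟩ := havail k hk1 hk2 hk3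
    refine le_trans ?_ (h.best i l (by omega) (Or.inr hav))
    have hcong : itemUtil c x M l v = itemUtil c x M (max l (k - w + 1)) v :=
      itemUtil_congr hl1 (le_max_left _ _) (by omega) (fun r h1 h2 => hl0 r h1 (by omega)) v
    rw [hcong, itemUtil, if_neg (by omega), windowUtil]
    have hterm : ∀ r, k - w < r → r ≤ M → 0 ≤ c r * (v - x r) := fun r h1 h2 =>
      mul_nonneg (hc r (by omega)) (by
        have := hx (k - w) r (by omega) h1.le h2
        linarith)
    have hle : ∀ r, r ∈ Finset.Ioc w M →
        c r * (Set.Ioi (x (r - w))).indicator (fun t => t - x r) v ≤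
          if k ≤ r then c r * (v - x r) else 0 := fun r hr => by
      rw [Finset.mem_Ioc] at hr
      simp only [Set.indicator_apply, Set.mem_Ioi]
      split_ifs with h1 h2 h2
      · exact le_rfl
      · have hcr : c r = 0 := le_antisymm
          (not_lt.1 fun hcr => hmin r (by omega) ⟨hr.1, hr.2, hcr, h1⟩) (hc r (by omega))
        rw [hcr, zero_mul]
      · rw [mul_zero]
        exact hterm r (by omega) hr.2
      · rw [mul_zero]
    refine (Finset.sum_le_sum hle).trans ?_
    rw [← Finset.sum_filter]
    refine Finset.sum_le_sum_of_subset_of_nonneg (fun r hr => ?_) fun r hr _ => ?_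
    · simp only [Finset.mem_filter, Finset.mem_Ioc, Finset.mem_Ico] at hr ⊢
      omega
    · simp only [Finset.mem_Ico] at hr
      exact hterm r (by omega) (by omega)
  · push Not at hex
    have h1 := h.best i 0 (by omega) (Or.inl rfl)
    rw [itemUtil_zero] at h1
    refine le_trans (Finset.sum_nonpos fun k hk => ?_) h1
    rw [Finset.mem_Ioc] at hk
    simp only [Set.indicator_apply, Set.mem_Ioi]
    split_ifs with h2
    · have := hex k hk.1 hk.2
      have hck : c k = 0 := le_antisymm
        (not_lt.1 fun hck => absurd h2 (not_lt.2 (this hck))) (hc k (by omega))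
      rw [hck, zero_mul]
    · rw [mul_zero]

/-- Welfare is revenue plus utility. -/
lemma sum_price_add_sum_util_le (hc : ∀ k, 1 ≤ k → 0 ≤ c k)
    (hx0 : ∀ k, 1 ≤ k → k ≤ M → 0 ≤ x k) (S : Finset ℕ) (hS : ∀ j ∈ S, ∃ i, o i = j)
    (g : Fin n → ℝ) (hg : ∀ i, g i ≤ itemUtil c x M (o i) (t i)) :
    ∑ j ∈ S, itemPrice c x M j + ∑ i, g i ≤ ∑ i, itemMult c M (o i) * t i := by
  classical
  simp only [itemMult_mul (x := x), Finset.sum_add_distrib]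
  refine add_le_add ?_ (Finset.sum_le_sum fun i _ => hg i)
  obtain rfl | ⟨j₀, hj₀⟩ := S.eq_empty_or_nonempty
  · exact Finset.sum_nonneg fun i _ => itemPrice_nonneg hc hx0 _
  have : Nonempty (Fin n) := (hS j₀ hj₀).nonempty
  choose! f hf using hS
  calc ∑ j ∈ S, itemPrice c x M j = ∑ j ∈ S, itemPrice c x M (o (f j)) :=
        Finset.sum_congr rfl fun j hj => by rw [hf j hj]
    _ = ∑ i ∈ S.image f, itemPrice c x M (o i) := by
        rw [Finset.sum_image fun j hj j' hj' hjj' => by rw [← hf j hj, ← hf j' hj', hjj']]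
    _ ≤ ∑ i, itemPrice c x M (o i) :=
        Finset.sum_le_sum_of_subset_of_nonneg (Finset.subset_univ _) fun i _ _ =>
          itemPrice_nonneg hc hx0 _

/-- As long as two sales have handed out the same multipliers, an option as good as the choice of
the next buyer in one of them is open in the other one. -/
lemma IsSale.exists_itemMult_eq (h : IsSale c x M t o) {i : Fin n}
    (heq : ∀ i' < i, itemMult c M (o i') = itemMult c M (o' i')) :
    ∃ l ≤ M, (l = 0 ∨ ∀ i' < i, o' i' ≠ l) ∧ itemMult c M l = itemMult c M (o i) := by
  classical
  have : Nonempty (Fin n) := ⟨i⟩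
  by_contra! H
  have hi0 : itemMult c M (o i) ≠ 0 := fun h0 => H 0 (by omega) (Or.inl rfl) (by simp [h0])
  let S : Finset ℕ := (Finset.Icc 1 M).filter fun l => itemMult c M l = itemMult c M (o i)
  have hne0 : ∀ j, itemMult c M j ≠ 0 → j ≠ 0 := fun j hj hj0 => hj (by simp [hj0])
  have hsold : ∀ l ∈ S, ∃ i' < i, o' i' = l := fun l hl => by
    simp only [S, Finset.mem_filter, Finset.mem_Icc] at hl
    by_contra! hno
    exact H l hl.1.2 (Or.inr hno) hl.2
  choose! f hfi hfo using hsold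
  have hmult : ∀ l ∈ S, itemMult c M (o (f l)) = itemMult c M (o i) := fun l hl => by
    rw [heq _ (hfi l hl), hfo l hl]
    exact (Finset.mem_filter.1 hl).2
  have hmaps : Set.MapsTo (fun l => o (f l)) (S : Set ℕ) (S : Set ℕ) := fun l hl => by
    refine Finset.mem_coe.2 (Finset.mem_filter.2 ⟨Finset.mem_Icc.2 ⟨?_, h.le _⟩, hmult l hl⟩)
    exact Nat.one_le_iff_ne_zero.2 (hne0 _ (by rw [hmult l hl]; exact hi0))
  have hinj : Set.InjOn (fun l => o (f l)) (S : Set ℕ) := fun l hl l' hl' hll' => by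
    have := h.inj _ _ (hne0 _ (by rw [hmult l hl]; exact hi0)) hll'
    rw [← hfo l hl, ← hfo l' hl', this]
  have hsurj := Finset.surjOn_of_injOn_of_card_le _ hmaps hinj le_rfl
  have hmem : o i ∈ (S : Set ℕ) := Finset.mem_coe.2 (Finset.mem_filter.2
    ⟨Finset.mem_Icc.2 ⟨Nat.one_le_iff_ne_zero.2 (hne0 _ hi0), h.le _⟩, rfl⟩)
  obtain ⟨l, hl, hlo⟩ := hsurj hmem
  exact (hfi l hl).ne (h.inj i _ (hne0 _ hi0) hlo.symm).symm

/-- If no buyer is indifferent between options with different multipliers, then tie-breaking does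
not affect the multipliers that the buyers receive. -/
lemma IsSale.itemMult_eq (h : IsSale c x M t o) (h' : IsSale c x M t o')
    (hc : ∀ k, 1 ≤ k → 0 ≤ c k)
    (hgen : ∀ i, ∀ j ≤ M, ∀ l ≤ M, itemUtil c x M j (t i) = itemUtil c x M l (t i) →
      itemMult c M j = itemMult c M l) (i : Fin n) :
    itemMult c M (o i) = itemMult c M (o' i) := by
  induction i using WellFoundedLT.induction with
  | ind i ih =>
    refine hgen i _ (h.le i) _ (h'.le i) (le_antisymm ?_ ?_)
    · obtain ⟨l, hl, hav, hm⟩ := h.exists_itemMult_eq (i := i) ih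
      rw [← itemUtil_eq_of_itemMult_eq hc hl (h.le i) hm]
      exact h'.best i l hl hav
    · obtain ⟨l, hl, hav, hm⟩ := h'.exists_itemMult_eq (i := i) fun i' hi' => (ih i' hi').symm
      rw [← itemUtil_eq_of_itemMult_eq hc hl (h'.le i) hm]
      exact h.best i l hl hav

end ItemNumbers

/-! ### Posted-price outcomes as sequential sales -/

section Translation

/-- The largest number of an item that is kept, provided that there are enough items. -/
noncomputable def keptCount (n : ℕ) : ℕ := ⌊(n : ℝ) - (n : ℝ) ^ (5 / 6 : ℝ)⌋₊

lemma rpow_five_sixths_le (n : ℕ) : (n : ℝ) ^ (5 / 6 : ℝ) ≤ n := by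
  obtain rfl | hn := Nat.eq_zero_or_pos n
  · norm_num
  · exact Real.rpow_le_self_of_one_le (by exact_mod_cast hn) (by norm_num)

lemma kept_iff (n k : ℕ) : Kept n k ↔ k ≤ keptCount n :=
  (Nat.le_floor_iff (sub_nonneg.2 (rpow_five_sixths_le n))).symm

lemma keptCount_le (n : ℕ) : keptCount n ≤ n := by
  refine Nat.floor_le_of_le ?_
  linarith [Real.rpow_nonneg (Nat.cast_nonneg n : (0 : ℝ) ≤ n) (5 / 6)]

variable {n m : ℕ} {α : Fin m → ℝ}

lemma truncMult_of_le {k : ℕ} (h1 : 1 ≤ k) (h2 : k ≤ m) (h3 : k ≤ keptCount n) :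
    truncMult n α k = α ⟨k - 1, by omega⟩ := by
  rw [truncMult, dif_pos ⟨h1, h2, (kept_iff n k).2 h3⟩]

lemma truncMult_of_lt {k : ℕ} (h : min m (keptCount n) < k) : truncMult n α k = 0 := by
  rw [truncMult, dif_neg]
  rintro ⟨-, h2, h3⟩
  rw [kept_iff] at h3
  omega

lemma truncMult_nonneg (hα : ∀ j, 0 ≤ α j) (k : ℕ) : 0 ≤ truncMult n α k := by
  unfold truncMult
  split_ifs
  · exact hα _
  · rfl

/-- The drop of the truncated multipliers after item number `k`. -/
noncomputable def multDrop (n : ℕ) {m : ℕ} (α : Fin m → ℝ) (k : ℕ) : ℝ :=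
  truncMult n α k - truncMult n α (k + 1)

lemma multDrop_nonneg (hα : ∀ j, 0 ≤ α j) (hanti : Antitone α) {k : ℕ} (hk : 1 ≤ k) :
    0 ≤ multDrop n α k := by
  rw [multDrop, sub_nonneg]
  by_cases h : k + 1 ≤ min m (keptCount n)
  · rw [truncMult_of_le (by omega) (by omega) (by omega),
      truncMult_of_le (by omega) (by omega) (by omega)]
    exact hanti (Fin.mk_le_mk.2 (by omega))
  · rw [truncMult_of_lt (by omega)]
    exact truncMult_nonneg hα k

lemma multDrop_of_lt {k : ℕ} (h : min m (keptCount n) < k) : multDrop n α k = 0 := by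
  rw [multDrop, truncMult_of_lt h, truncMult_of_lt (by omega), sub_zero]

lemma itemMult_multDrop {j : ℕ} (h1 : 1 ≤ j) (h2 : j ≤ min m (keptCount n)) :
    itemMult (multDrop n α) (min m (keptCount n)) j = truncMult n α j := by
  rw [itemMult, if_neg (by omega)]
  have : ∀ N, j ≤ N →
      ∑ k ∈ Finset.Ico j N, multDrop n α k = truncMult n α j - truncMult n α N := fun N hN => by
    induction N, hN using Nat.le_induction with
    | base => simp
    | succ N hN ih => rw [Finset.sum_Ico_succ_top hN, ih, multDrop]; ring
  rw [this _ (by omega), truncMult_of_lt (Nat.lt_succ_self _), sub_zero]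

/-- The breakpoint `F⁻¹(1 - q_k)`. -/
noncomputable def breakpoint (n : ℕ) (μ : Measure ℝ) (k : ℕ) : ℝ :=
  quantile μ (1 - saleProb n k)

lemma staticPrice_of_le {μ : Measure ℝ} (j : Fin m) (hj : (j : ℕ) + 1 ≤ keptCount n) :
    staticPrice n μ α j =
      (itemPrice (multDrop n α) (breakpoint n μ) (min m (keptCount n)) (j + 1) : ℝ) := by
  rw [staticPrice, if_pos ((kept_iff _ _).2 hj), itemPrice, if_neg (by omega)]
  congr 1
  refine (Finset.sum_subset (fun k hk => ?_) fun k hk hk' => ?_).symm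
  · have := keptCount_le n
    simp only [Finset.mem_Ico, Finset.mem_Icc] at hk ⊢
    omega
  · simp only [Finset.mem_Ico, Finset.mem_Icc] at hk hk'
    change multDrop n α k * _ = 0
    rw [multDrop_of_lt (by omega), zero_mul]

lemma staticPrice_of_gt {μ : Measure ℝ} (j : Fin m) (hj : keptCount n < (j : ℕ) + 1) :
    staticPrice n μ α j = ⊤ := by
  rw [staticPrice, if_neg (by rw [kept_iff]; omega)]

/-- The number of an item, counted from one; `0` if there is no item. -/
def itemNumber (o : Option (Fin m)) : ℕ := o.elim 0 fun j => (j : ℕ) + 1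

lemma utility_of_le {μ : Measure ℝ} (t : Fin n → ℝ) (i : Fin n) (j : Fin m)
    (hj : (j : ℕ) + 1 ≤ keptCount n) :
    utility (separableValue α t) (staticPrice n μ α) i j =
      (itemUtil (multDrop n α) (breakpoint n μ) (min m (keptCount n)) (j + 1) (t i) : ℝ) := by
  have h := itemMult_mul (c := multDrop n α) (x := breakpoint n μ) (M := min m (keptCount n))
    (j + 1) (t i)
  rw [itemMult_multDrop (by omega) (by omega), truncMult_of_le (by omega) (by omega) hj] at h
  rw [utility, staticPrice_of_le j hj, ← EReal.coe_sub, separableValue]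
  congr 1
  exact sub_eq_iff_eq_add'.2 h

lemma utility_of_gt {μ : Measure ℝ} (t : Fin n → ℝ) (i : Fin n) (j : Fin m)
    (hj : keptCount n < (j : ℕ) + 1) :
    utility (separableValue α t) (staticPrice n μ α) i j = ⊥ := by
  rw [utility, staticPrice_of_gt j hj, EReal.sub_top]

variable {t : Fin n → ℝ} {a : Fin n → Option (Fin m)} {μ : Measure ℝ}

lemma IsOutcome.le_keptCount (h : IsOutcome (separableValue α t) (staticPrice n μ α) a)
    {i : Fin n} {j : Fin m} (hj : a i = some j) : (j : ℕ) + 1 ≤ keptCount n := by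
  by_contra! hlt
  have := (h.of_some i j hj).2.1
  rw [utility_of_gt t i j hlt] at this
  exact absurd this (by simp)

lemma IsOutcome.isSale (h : IsOutcome (separableValue α t) (staticPrice n μ α) a) :
    IsSale (multDrop n α) (breakpoint n μ) (min m (keptCount n)) t
      (fun i => itemNumber (a i)) where
  le i := by
    rcases hi : a i with _ | j
    · simp [itemNumber]
    · have := h.le_keptCount hi
      simp only [itemNumber, Option.elim_some]
      omega
  inj i i' h0 heq := by
    rcases hi : a i with _ | j
    · simp [hi, itemNumber] at h0
    rcases hi' : a i' with _ | j'
    · simp [hi, hi', itemNumber] at heq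
    obtain rfl : j = j' := by
      simp only [hi, hi', itemNumber, Option.elim_some] at heq
      exact Fin.ext (by omega)
    rcases lt_trichotomy i i' with hlt | heq | hlt
    · exact absurd hi ((h.of_some i' j hi').1 i hlt)
    · exact heq
    · exact absurd hi' ((h.of_some i j hi).1 i' hlt)
  best i l hl hav := by
    obtain rfl | hl0 := Nat.eq_zero_or_pos l
    · rw [itemUtil_zero]
      rcases hi : a i with _ | j
      · simp [itemNumber]
      · have := (h.of_some i j hi).2.1
        rw [utility_of_le t i j (h.le_keptCount hi)] at this
        exact_mod_cast this
    · have hav' := hav.resolve_left hl0.ne'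
      let k : Fin m := ⟨l - 1, by omega⟩
      have hkl : (k : ℕ) + 1 = l := by simp only [k]; omega
      have hA : Available a i k := fun i' hi' hk => hav' i' hi' (by
        simp only [hk, itemNumber, Option.elim_some, hkl])
      have hu := utility_of_le (μ := μ) (α := α) t i k (by omega)
      rw [hkl] at hu
      rcases hi : a i with _ | j
      · have := h.of_none i hi k hA
        rw [hu] at this
        simp only [itemNumber, Option.elim_none, itemUtil_zero]
        exact_mod_cast this
      · have := (h.of_some i j hi).2.2 k hA
        rw [hu, utility_of_le t i j (h.le_keptCount hi)] at this
        exact_mod_cast this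

lemma IsOutcome.welfare_eq (h : IsOutcome (separableValue α t) (staticPrice n μ α) a) :
    welfare (separableValue α t) a =
      ∑ i, itemMult (multDrop n α) (min m (keptCount n)) (itemNumber (a i)) * t i := by
  refine Finset.sum_congr rfl fun i _ => ?_
  rcases hi : a i with _ | j
  · simp [itemNumber]
  · have := h.le_keptCount hi
    simp only [itemNumber, Option.elim_some]
    rw [itemMult_multDrop (by omega) (by omega), truncMult_of_le (by omega) (by omega) this]
    rfl

end Translation

/-! ### An upper bound on the optimal welfare -/

section Optimum

variable {n m : ℕ} {α : Fin m → ℝ}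

lemma IsMatching.card_le {a : Fin n → Option (Fin m)} (ha : IsMatching a) (k : ℕ) :
    (Finset.univ.filter fun i => ∃ j, a i = some j ∧ (j : ℕ) + 1 ≤ k).card ≤ k := by
  classical
  have : (Finset.univ.filter fun i => ∃ j, a i = some j ∧ (j : ℕ) + 1 ≤ k).card ≤
      (Finset.Icc 1 k).card := by
    refine Finset.card_le_card_of_injOn (fun i => itemNumber (a i)) (fun i hi => ?_)
      fun i hi i' hi' heq => ?_
    · simp only [Finset.coe_filter, Finset.mem_univ, true_and, Set.mem_ofPred_eq] at hi
      obtain ⟨j, hj, hjk⟩ := hi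
      simp [hj, itemNumber, hjk]
    · simp only [Finset.coe_filter, Finset.mem_univ, true_and, Set.mem_ofPred_eq] at hi hi'
      obtain ⟨j, hj, hjk⟩ := hi
      obtain ⟨j', hj', hjk'⟩ := hi'
      simp only [hj, hj', itemNumber, Option.elim_some] at heq
      obtain rfl : j = j' := Fin.ext (by omega)
      exact ha i i' j hj hj'
  simpa using this

/-- The types of `N` buyers sum up to at most `N * y` plus the excesses of all types over `y`. The
first `k` items go to at most `k` buyers, which bounds the optimum if no items are discarded. If
some are, then discarded items are charged to the last item that is kept; it serves up to `n`
instead of `keptCount n` buyers. -/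
lemma optWelfare_le (hα : ∀ j, 0 ≤ α j) (hanti : Antitone α) (hK : 1 ≤ keptCount n)
    {t : Fin n → ℝ} (ht : ∀ i, 0 ≤ t i) {y : ℕ → ℝ} (hy : ∀ k, 0 ≤ y k) :
    optWelfare (separableValue α t) ≤
      ∑ k ∈ Finset.Icc 1 (min m (keptCount n)), multDrop n α k *
        ((n : ℝ) / keptCount n * (k * y k) + ∑ i, max (t i - y k) 0) := by
  classical
  set K := keptCount n
  set M := min m K
  set c := multDrop n α
  have hc : ∀ k, 1 ≤ k → 0 ≤ c k := fun k hk => multDrop_nonneg hα hanti hk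
  have : Nonempty {a : Fin n → Option (Fin m) // IsMatching a} :=
    ⟨⟨fun _ => none, fun _ _ _ h => by simp at h⟩⟩
  refine ciSup_le fun ⟨a, ha⟩ => ?_
  let P : ℕ → Fin n → Prop := fun k i => ∃ j, a i = some j ∧ ((j : ℕ) + 1 ≤ k ∨ k = K)
  have hα_le : ∀ j : Fin m,
      α j ≤ ∑ k ∈ Finset.Icc 1 M, if (j : ℕ) + 1 ≤ k ∨ k = K then c k else 0 := fun j => by
    have hnn : ∀ k ∈ Finset.Icc 1 M, 0 ≤ if (j : ℕ) + 1 ≤ k ∨ k = K then c k else 0 :=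
      fun k hk => by
        split_ifs
        · exact hc k (Finset.mem_Icc.1 hk).1
        · rfl
    rcases le_or_gt ((j : ℕ) + 1) K with hjK | hjK
    · have h1 : itemMult c M (j + 1) = α j := by
        rw [itemMult_multDrop (by omega) (by omega), truncMult_of_le (by omega) (by omega) hjK]
        rfl
      rw [← h1, itemMult, if_neg (by omega)]
      calc ∑ k ∈ Finset.Ico ((j : ℕ) + 1) (M + 1), c k
          = ∑ k ∈ Finset.Ico ((j : ℕ) + 1) (M + 1),
              if (j : ℕ) + 1 ≤ k ∨ k = K then c k else 0 :=
            Finset.sum_congr rfl fun k hk => by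
              rw [if_pos (Or.inl (Finset.mem_Ico.1 hk).1)]
        _ ≤ _ := Finset.sum_le_sum_of_subset_of_nonneg (fun k hk => by
              simp only [Finset.mem_Ico, Finset.mem_Icc] at hk ⊢; omega) fun k hk _ => hnn k hk
    · have hjm := j.2
      refine le_trans ?_ (Finset.single_le_sum hnn (Finset.mem_Icc.2 ⟨hK, by omega⟩ :
        K ∈ Finset.Icc 1 M))
      rw [if_pos (Or.inr rfl)]
      change α j ≤ truncMult n α K - truncMult n α (K + 1)
      rw [truncMult_of_le hK (by omega) le_rfl, truncMult_of_lt (by omega), sub_zero]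
      exact hanti (Fin.mk_le_of_le_val (by omega))
  have hbuyer : ∀ i, (a i).elim 0 (separableValue α t i) ≤
      ∑ k ∈ Finset.Icc 1 M, c k * ((if P k i then y k else 0) + max (t i - y k) 0) := fun i => by
    have hnn : ∀ k, 0 ≤ (if P k i then y k else 0) + max (t i - y k) 0 := fun k =>
      add_nonneg (by split_ifs; exacts [hy k, le_rfl]) (le_max_right _ _)
    obtain hi | ⟨j, hi⟩ := (a i).eq_none_or_eq_some
    · rw [show (a i).elim 0 (separableValue α t i) = 0 by rw [hi]; rfl]
      exact Finset.sum_nonneg fun k hk => mul_nonneg (hc k (Finset.mem_Icc.1 hk).1) (hnn k)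
    · rw [show (a i).elim 0 (separableValue α t i) = α j * t i by rw [hi]; rfl]
      refine (mul_le_mul_of_nonneg_right (hα_le j) (ht i)).trans ?_
      rw [Finset.sum_mul]
      refine Finset.sum_le_sum fun k hk => ?_
      have hck := hc k (Finset.mem_Icc.1 hk).1
      split_ifs with h1 h2 h2
      · exact mul_le_mul_of_nonneg_left (by linarith [le_max_left (t i - y k) 0]) hck
      · exact absurd ⟨j, hi, h1⟩ h2
      · rw [zero_mul]
        exact mul_nonneg hck (add_nonneg (hy k) (le_max_right _ _))
      · rw [zero_mul]
        exact mul_nonneg hck (add_nonneg le_rfl (le_max_right _ _))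
  refine (Finset.sum_le_sum fun i _ => hbuyer i).trans ?_
  rw [Finset.sum_comm]
  refine Finset.sum_le_sum fun k hk => ?_
  rw [← Finset.mul_sum, Finset.sum_add_distrib]
  refine mul_le_mul_of_nonneg_left (add_le_add_left ?_ _) (hc k (Finset.mem_Icc.1 hk).1)
  rw [← Finset.sum_filter, Finset.sum_const, nsmul_eq_mul, ← mul_assoc]
  refine mul_le_mul_of_nonneg_right ?_ (hy k)
  have hKpos : (0 : ℝ) < K := by exact_mod_cast hK
  rw [div_mul_eq_mul_div, le_div_iff₀ hKpos]
  have hKn : (K : ℝ) ≤ n := by exact_mod_cast keptCount_le n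
  by_cases hkK : k = K
  · rw [hkK]
    refine mul_le_mul_of_nonneg_right ?_ hKpos.le
    exact_mod_cast (Finset.card_filter_le _ _).trans (by simp)
  · have h1 : (Finset.univ.filter fun i => P k i).card ≤ k := by
      convert ha.card_le k using 4 with i
      simp only [hkK, or_false]
    have h2 : (((Finset.univ.filter fun i => P k i).card : ℕ) : ℝ) ≤ k := by exact_mod_cast h1
    nlinarith [(Nat.cast_nonneg k : (0 : ℝ) ≤ k)]

end Optimum

/-! ### Estimates for a large number of buyers -/

section LargeMarkets

/-- The inequalities from which all estimates for large `n` follow. -/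
structure IsLarge (n : ℕ) : Prop where
  one_le_loglog : 1 ≤ Real.log (Real.log n)
  one_le_logloglog : 1 ≤ Real.log (Real.log (Real.log n))
  log_le : 4 * Real.log n ≤ (n : ℝ) ^ (1 / 8 : ℝ)

lemma eventually_isLarge : ∃ N : ℕ, ∀ n, N ≤ n → IsLarge n := by
  have hcast := tendsto_natCast_atTop_atTop (R := ℝ)
  have hlog := Real.tendsto_log_atTop
  have h1 := (hlog.comp (hlog.comp (hlog.comp hcast))).eventually_ge_atTop 1
  have h3 := (hlog.comp (hlog.comp hcast)).eventually_ge_atTop 1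
  have h2 := hcast.eventually
    ((isLittleO_log_rpow_atTop (by norm_num : (0 : ℝ) < 1 / 8)).bound
      (by norm_num : (0 : ℝ) < 1 / 4))
  obtain ⟨N, hN⟩ := Filter.eventually_atTop.1 (h3.and (h1.and h2))
  refine ⟨N, fun n hn => ⟨(hN n hn).1, (hN n hn).2.1, ?_⟩⟩
  have h := (hN n hn).2.2
  rw [Real.norm_of_nonneg (Real.rpow_nonneg (Nat.cast_nonneg n) _)] at h
  have := Real.le_norm_self (Real.log n)
  linarith

/-- The size of the fluctuations of the number of buyers above a breakpoint. -/
noncomputable def deviation (n : ℕ) : ℝ := √(n * Real.log n)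

/-- The length of the windows of items that are not sold out. -/
noncomputable def window (n : ℕ) : ℕ := ⌈(n : ℝ) ^ (3 / 4 : ℝ)⌉₊

namespace IsLarge

variable {n : ℕ} (h : IsLarge n)
include h

lemma two_le_log : 2 ≤ Real.log n := by
  have h1 := h.one_le_loglog
  have hpos : 0 < Real.log n := by
    refine (Real.log_natCast_nonneg n).lt_of_ne fun h0 => ?_
    rw [← h0, Real.log_zero] at h1
    linarith
  rw [Real.le_log_iff_exp_le hpos] at h1
  linarith [Real.exp_one_gt_d9]

lemma pos : 0 < (n : ℝ) := by
  rcases Nat.eq_zero_or_pos n with rfl | hn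
  · have := h.two_le_log; norm_num at this
  · exact_mod_cast hn

lemma eight_le_rpow : 8 ≤ (n : ℝ) ^ (1 / 8 : ℝ) := by linarith [h.log_le, h.two_le_log]

lemma rpow_eq_pow (k : ℕ) : (n : ℝ) ^ ((k : ℝ) / 8) = ((n : ℝ) ^ (1 / 8 : ℝ)) ^ k := by
  rw [← Real.rpow_natCast, ← Real.rpow_mul h.pos.le]; ring_nf

lemma eq_pow : (n : ℝ) = ((n : ℝ) ^ (1 / 8 : ℝ)) ^ 8 := by
  rw [← h.rpow_eq_pow 8]; norm_num

lemma rpow_three_quarters : (n : ℝ) ^ (3 / 4 : ℝ) = ((n : ℝ) ^ (1 / 8 : ℝ)) ^ 6 := by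
  rw [← h.rpow_eq_pow 6]; norm_num

lemma rpow_seven_eighths : (n : ℝ) ^ (7 / 8 : ℝ) = ((n : ℝ) ^ (1 / 8 : ℝ)) ^ 7 := by
  rw [← h.rpow_eq_pow 7]; norm_num

lemma one_le_cast : 1 ≤ (n : ℝ) := by
  rw [h.eq_pow]
  exact one_le_pow₀ (by linarith [h.eight_le_rpow])

lemma deviation_pos : 0 < deviation n :=
  Real.sqrt_pos.2 (mul_pos h.pos (by linarith [h.two_le_log]))

lemma sq_deviation : deviation n ^ 2 = n * Real.log n :=
  Real.sq_sqrt (mul_nonneg h.pos.le (by linarith [h.two_le_log]))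

lemma deviation_mul_log_lt : 3 * deviation n * Real.log n < (n : ℝ) ^ (3 / 4 : ℝ) := by
  have h2 := h.two_le_log
  have hd := h.deviation_pos
  refine lt_of_pow_lt_pow_left₀ 2 (Real.rpow_nonneg h.pos.le _) ?_
  have hb := h.eight_le_rpow
  have hl := h.log_le
  rw [h.rpow_three_quarters]
  have hn := h.eq_pow
  set b := (n : ℝ) ^ (1 / 8 : ℝ)
  have h3 : Real.log n ^ 3 ≤ (b / 4) ^ 3 := pow_le_pow_left₀ (by linarith) (by linarith) 3
  calc (3 * deviation n * Real.log n) ^ 2 = 9 * (n * Real.log n ^ 3) := by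
        rw [mul_pow, mul_pow, h.sq_deviation]; ring
    _ ≤ 9 * (n * (b / 4) ^ 3) := by gcongr
    _ = 9 / 64 * b ^ 11 := by rw [hn]; ring
    _ < 1 * b ^ 12 := by
        have : 0 < b ^ 11 := by positivity
        rw [pow_succ b 11]
        nlinarith
    _ = (b ^ 6) ^ 2 := by ring

lemma deviation_lt_window :
    3 * deviation n < 1 / Real.log n * window n := by
  have h1 := h.deviation_mul_log_lt
  have h2 : (n : ℝ) ^ (3 / 4 : ℝ) ≤ window n := Nat.le_ceil _
  have h3 := h.two_le_log
  rw [one_div_mul_eq_div, lt_div_iff₀ (by linarith)]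
  linarith

lemma one_le_window : 1 ≤ window n :=
  Nat.one_le_ceil_iff.2 (Real.rpow_pos_of_pos h.pos _)

lemma window_le {k : ℕ} (hk : (n : ℝ) ^ (7 / 8 : ℝ) ≤ k) : window n ≤ 1 / Real.log n * k := by
  have h1 : (window n : ℝ) < (n : ℝ) ^ (3 / 4 : ℝ) + 1 :=
    Nat.ceil_lt_add_one (Real.rpow_nonneg h.pos.le _)
  have hb := h.eight_le_rpow
  have hl := h.log_le
  have h2 := h.two_le_log
  rw [h.rpow_three_quarters] at h1
  rw [h.rpow_seven_eighths] at hk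
  set b := (n : ℝ) ^ (1 / 8 : ℝ)
  rw [one_div_mul_eq_div, le_div_iff₀ (by linarith)]
  have hb6 : 1 ≤ b ^ 6 := one_le_pow₀ (by linarith)
  calc (window n : ℝ) * Real.log n ≤ (b ^ 6 + b ^ 6) * (b / 4) := by
        gcongr <;> linarith
    _ ≤ b ^ 7 := by
        have : 0 < b ^ 7 := by positivity
        linarith [(by ring : (b ^ 6 + b ^ 6) * (b / 4) = b ^ 7 / 2)]
    _ ≤ k := hk

lemma le_keptCount : (1 - 1 / Real.log n) * n ≤ keptCount n := by
  have h1 : (n : ℝ) - (n : ℝ) ^ (5 / 6 : ℝ) < keptCount n + 1 := Nat.lt_floor_add_one _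
  have h2 : (n : ℝ) ^ (5 / 6 : ℝ) ≤ (n : ℝ) ^ (7 / 8 : ℝ) :=
    Real.rpow_le_rpow_of_exponent_le h.one_le_cast (by norm_num)
  have hb := h.eight_le_rpow
  have hl := h.log_le
  have h3 := h.two_le_log
  rw [h.rpow_seven_eighths] at h2
  have hn := h.eq_pow
  set b := (n : ℝ) ^ (1 / 8 : ℝ)
  have hb7 : 1 ≤ b ^ 7 := one_le_pow₀ (by linarith)
  have h4 : 2 * b ^ 7 ≤ 1 / Real.log n * n := by
    rw [one_div_mul_eq_div, le_div_iff₀ (by linarith)]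
    calc 2 * b ^ 7 * Real.log n ≤ 2 * b ^ 7 * (b / 4) := by gcongr; linarith
      _ = b ^ 8 / 2 := by ring
      _ ≤ n := by rw [← hn]; linarith [h.pos]
  linarith

lemma one_le_keptCount : 1 ≤ keptCount n := by
  have h1 := h.le_keptCount
  have h2 := h.two_le_log
  have h3 : 1 / Real.log n ≤ 1 / 2 := one_div_le_one_div_of_le (by norm_num) h2
  have : (0 : ℝ) < keptCount n := by nlinarith [h.pos]
  exact_mod_cast this

lemma two_mul_log_le : 2 * Real.log n ≤ n := by
  have h1 : (n : ℝ) ^ (1 / 8 : ℝ) ≤ n := Real.rpow_le_self_of_one_le h.one_le_cast (by norm_num)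
  have := h.log_le
  have := h.two_le_log
  linarith

/-! ### The sale probabilities -/

lemma sqrt_log_div : √(Real.log n / n) = deviation n / n := by
  have hn := h.pos.ne'
  rw [deviation, show Real.log n / n = n * Real.log n / (n : ℝ) ^ 2 by field_simp,
    Real.sqrt_div (mul_nonneg h.pos.le (by linarith [h.two_le_log])), Real.sqrt_sq h.pos.le]

lemma saleProb_le (k : ℕ) : n * saleProb n k ≤ k + deviation n := by
  have : saleProb n k ≤ (k : ℝ) / n + deviation n / n := by
    rw [← h.sqrt_log_div]; exact min_le_right _ _
  calc (n : ℝ) * saleProb n k ≤ n * ((k : ℝ) / n + deviation n / n) :=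
        mul_le_mul_of_nonneg_left this h.pos.le
    _ = _ := by have := h.pos.ne'; field_simp

lemma saleProb_pos {k : ℕ} (hk : 1 ≤ k) : 0 < saleProb n k := by
  have hk' : (0 : ℝ) < k := by exact_mod_cast hk
  have := h.pos
  have h1 := h.one_le_loglog
  exact lt_min (by positivity) (by positivity)

lemma div_le_saleProb (k : ℕ) : (k : ℝ) / n ≤ saleProb n k := by
  have hk : 0 ≤ (k : ℝ) / n := by positivity
  have h1 := h.one_le_loglog
  exact le_min (le_mul_of_one_le_right hk (by linarith))
    (by linarith [Real.sqrt_nonneg (Real.log n / n)])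

lemma saleProb_mono : Monotone (saleProb n) := fun k l hkl => by
  have hkl' : (k : ℝ) / n ≤ l / n := by gcongr
  have h1 := h.one_le_loglog
  exact min_le_min (mul_le_mul_of_nonneg_right hkl' (by linarith)) (by linarith)

lemma saleProb_lt_one {k : ℕ} (hk : k ≤ keptCount n) : saleProb n k < 1 := by
  have h1 : (k : ℝ) ≤ n - (n : ℝ) ^ (5 / 6 : ℝ) := (kept_iff n k).2 hk
  have h2 : (n : ℝ) ^ (3 / 4 : ℝ) ≤ (n : ℝ) ^ (5 / 6 : ℝ) :=
    Real.rpow_le_rpow_of_exponent_le h.one_le_cast (by norm_num)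
  have h3 := h.deviation_mul_log_lt
  have h4 := h.saleProb_le k
  have h5 := h.two_le_log
  have h6 := h.deviation_pos
  have h7 := h.pos
  by_contra! hge
  nlinarith

lemma sub_mul_saleProb_le {k w : ℕ} (hw : w ≤ k) :
    (1 - (w : ℝ) / k) * saleProb n k ≤ saleProb n (k - w) := by
  rcases Nat.eq_zero_or_pos k with rfl | hk
  · simp [Nat.le_zero.1 hw]
  have hk' : (0 : ℝ) < k := by exact_mod_cast hk
  have hw' : (w : ℝ) ≤ k := by exact_mod_cast hw
  have h0 : 0 ≤ 1 - (w : ℝ) / k := sub_nonneg.2 (div_le_one_of_le₀ hw' hk'.le)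
  have h1 : (1 - (w : ℝ) / k) ≤ 1 := by
    have : 0 ≤ (w : ℝ) / k := by positivity
    linarith
  have hn := h.pos
  have hcast : ((k - w : ℕ) : ℝ) = (1 - (w : ℝ) / k) * k := by
    rw [Nat.cast_sub hw]; field_simp
  have hmul : ((k - w : ℕ) : ℝ) / n = (1 - (w : ℝ) / k) * ((k : ℝ) / n) := by
    rw [hcast, mul_div_assoc]
  rw [saleProb, saleProb, mul_min_of_nonneg _ _ h0, hmul]
  refine min_le_min (by rw [mul_assoc]) ?_
  rw [mul_add]
  exact add_le_add_right (mul_le_of_le_one_left (Real.sqrt_nonneg _) h1) _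

lemma log_saleProb_le {k : ℕ} (hk : 1 ≤ k) :
    Real.log (saleProb n k) ≤
      Real.log ((k : ℝ) / n) + Real.log (2 * Real.log (Real.log n)) := by
  have hk' : (0 : ℝ) < k := by exact_mod_cast hk
  have h1 := h.one_le_loglog
  have hn := h.pos
  rw [← Real.log_mul (by positivity) (by positivity)]
  exact Real.log_le_log (h.saleProb_pos hk) (min_le_left _ _)

/-! ### The breakpoints -/

variable {μ : Measure ℝ}

lemma measureReal_Ioi_breakpoint [IsProbabilityMeasure μ] [NullSingletonClass μ]
    {k : ℕ} (hk : 1 ≤ k) (hk' : k ≤ keptCount n) :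
    μ.real (Set.Ioi (breakpoint n μ k)) = saleProb n k :=
  measureReal_Ioi_quantile (h.saleProb_pos hk) (h.saleProb_lt_one hk')

lemma breakpoint_anti {k l : ℕ} (hk : 1 ≤ k) (hkl : k ≤ l) (hl : l ≤ keptCount n) :
    breakpoint n μ l ≤ breakpoint n μ k := by
  have := h.saleProb_pos hk
  have := h.saleProb_lt_one hl
  exact quantile_mono (by linarith) (by linarith [h.saleProb_mono hkl]) (by linarith)

lemma breakpoint_pos [IsProbabilityMeasure μ] [NullSingletonClass μ]
    (hμ : ∀ᵐ x ∂μ, 0 ≤ x) {k : ℕ} (hk : 1 ≤ k) (hk' : k ≤ keptCount n) :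
    0 < breakpoint n μ k := by
  have := h.saleProb_pos hk
  have := h.saleProb_lt_one hk'
  exact quantile_pos hμ (by linarith) (by linarith)

end IsLarge

end LargeMarkets

/-! ### Concentration of the number of buyers above a breakpoint -/

section Concentration

variable {n : ℕ} {μ : Measure ℝ} [IsProbabilityMeasure μ]

/-- The number of buyers in `I` whose type exceeds `x`. -/
noncomputable def countAbove (I : Finset (Fin n)) (x : ℝ) (t : Fin n → ℝ) : ℝ :=
  ∑ i ∈ I, (Set.Ioi x).indicator 1 (t i)

lemma measurable_countAbove (I : Finset (Fin n)) (x : ℝ) : Measurable (countAbove I x) :=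
  Finset.measurable_sum _ fun i _ =>
    (measurable_one.indicator measurableSet_Ioi).comp (measurable_pi_apply i)

lemma countAbove_eq_card (I : Finset (Fin n)) (x : ℝ) (t : Fin n → ℝ) :
    countAbove I x t = (I.filter fun i => x < t i).card := by
  simp [countAbove, Set.indicator_apply, Finset.sum_boole]

lemma ae_pi_of_ae {p : ℝ → Prop} (hp : ∀ᵐ x ∂μ, p x) :
    ∀ᵐ t ∂(Measure.pi fun _ : Fin n => μ), ∀ i, p (t i) :=
  ae_all_iff.2 fun i => (Measure.quasiMeasurePreserving_eval (fun _ : Fin n => μ) i).ae hp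

/-- Hoeffding's inequality for the number of buyers above `x`. -/
lemma measureReal_deviation_le (I : Finset (Fin n)) (x : ℝ) {s : ℝ} (hs : 0 < s) :
    (Measure.pi fun _ : Fin n => μ).real
        {t | s ≤ |countAbove I x t - I.card * μ.real (Set.Ioi x)|} ≤
      2 * Real.exp (-2 * s ^ 2 / n) := by
  set P := Measure.pi fun _ : Fin n => μ
  set Y : ℝ → ℝ := fun v => (Set.Ioi x).indicator (fun _ => (1 : ℝ)) v with hY
  have hYm : Measurable Y := measurable_const.indicator measurableSet_Ioi
  set X : Fin n → (Fin n → ℝ) → ℝ := fun i t => Y (t i) - μ.real (Set.Ioi x) with hX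
  have hindep : iIndepFun X P :=
    iIndepFun_pi (X := fun _ v => Y v - μ.real (Set.Ioi x))
      fun _ => (hYm.sub_const _).aemeasurable
  have hmean : ∀ i, ∫ t, Y (t i) ∂P = μ.real (Set.Ioi x) := fun i => by
    rw [integral_comp_eval (μ := fun _ : Fin n => μ) hYm.aestronglyMeasurable,
      integral_indicator_const _ measurableSet_Ioi, smul_eq_mul, mul_one]
  have hsub : ∀ i, HasSubgaussianMGF (X i) ((‖(1 : ℝ) - 0‖₊ / 2) ^ 2) P := fun i => by
    have := hasSubgaussianMGF_of_mem_Icc (μ := P) (X := fun t => Y (t i)) (a := 0) (b := 1)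
      (hYm.comp (measurable_pi_apply i)).aemeasurable (ae_of_all _ fun t => by
        simp only [hY, Set.indicator_apply]; split_ifs <;> simp)
    rwa [hmean i] at this
  have hsum : ∀ t, countAbove I x t - I.card * μ.real (Set.Ioi x) = ∑ i ∈ I, X i t := fun t => by
    simp only [hX, Finset.sum_sub_distrib, Finset.sum_const, nsmul_eq_mul]
    rfl
  have hbound : ∀ Z : Fin n → (Fin n → ℝ) → ℝ, iIndepFun Z P →
      (∀ i, HasSubgaussianMGF (Z i) ((‖(1 : ℝ) - 0‖₊ / 2) ^ 2) P) →
      P.real {t | s ≤ ∑ i ∈ I, Z i t} ≤ Real.exp (-2 * s ^ 2 / n) := fun Z hZ hZs => by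
    obtain rfl | hI := I.eq_empty_or_nonempty
    · simp [hs.not_ge]; positivity
    refine (HasSubgaussianMGF.measure_sum_ge_le_of_iIndepFun hZ (fun i _ => hZs i) hs.le).trans ?_
    rw [Real.exp_le_exp]
    have hc : (0 : ℝ) < I.card := by exact_mod_cast hI.card_pos
    have hcn : (I.card : ℝ) ≤ n := by
      exact_mod_cast (Finset.card_le_univ I).trans_eq (Fintype.card_fin n)
    simp only [Finset.sum_const, nsmul_eq_mul, sub_zero, nnnorm_one, NNReal.coe_mul,
      NNReal.coe_pow, NNReal.coe_div, NNReal.coe_one, NNReal.coe_natCast]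
    rw [neg_div, neg_mul, neg_div, neg_le_neg_iff, div_le_div_iff₀ (hc.trans_le hcn) (by positivity)]
    push_cast
    nlinarith [mul_le_mul_of_nonneg_left hcn (sq_nonneg s)]
  have hcover : {t | s ≤ |countAbove I x t - I.card * μ.real (Set.Ioi x)|} ⊆
      {t | s ≤ ∑ i ∈ I, X i t} ∪ {t | s ≤ ∑ i ∈ I, (-X i) t} := fun t ht => by
    simp only [Set.mem_ofPred_eq, hsum, Set.mem_union, Pi.neg_apply, Finset.sum_neg_distrib] at ht ⊢
    exact le_abs.1 ht
  calc P.real _ ≤ _ := measureReal_mono hcover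
    _ ≤ _ := measureReal_union_le _ _
    _ ≤ Real.exp (-2 * s ^ 2 / n) + Real.exp (-2 * s ^ 2 / n) :=
        add_le_add (hbound X hindep hsub) (hbound (fun i => -X i)
          (hindep.comp (fun _ v => -v) fun _ => measurable_neg) fun i => (hsub i).neg)
    _ = _ := by ring

/-- A lower tail bound for the number of buyers above `x`, by Markov's inequality for
`(1 / 2) ^ count`. -/
lemma measureReal_card_lt_le (x : ℝ) {l : ℕ} :
    (Measure.pi fun _ : Fin n => μ).real
        {t | (Finset.univ.filter fun i => x < t i).card < l} * (1 / 2) ^ (l - 1) ≤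
      Real.exp (-(n * μ.real (Set.Ioi x) / 2)) := by
  set P := Measure.pi fun _ : Fin n => μ
  set q := μ.real (Set.Ioi x)
  set Y : ℝ → ℝ := fun v => if x < v then 1 / 2 else 1 with hY
  have hYm : Measurable Y := Measurable.ite measurableSet_Ioi measurable_const measurable_const
  have hY0 : ∀ v, 0 ≤ Y v := fun v => by simp only [hY]; split_ifs <;> norm_num
  have hY1 : ∀ v, Y v ≤ 1 := fun v => by simp only [hY]; split_ifs <;> norm_num
  have hYint : ∫ v, Y v ∂μ = 1 - q / 2 := by
    have : Y = fun v => 1 - (Set.Ioi x).indicator (fun _ => (1 / 2 : ℝ)) v := by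
      funext v
      simp only [hY, Set.indicator_apply, Set.mem_Ioi]
      split_ifs <;> norm_num
    rw [this, integral_sub (integrable_const _)
      ((integrable_const _).indicator measurableSet_Ioi),
      integral_indicator_const _ measurableSet_Ioi]
    simp [q]; ring
  have hprod : ∀ t : Fin n → ℝ,
      ∏ i, Y (t i) = (1 / 2) ^ (Finset.univ.filter fun i => x < t i).card := fun t => by
    simp only [hY]
    rw [Finset.prod_ite, Finset.prod_const, Finset.prod_const_one, mul_one]
  have hint : Integrable (fun t : Fin n → ℝ => ∏ i, Y (t i)) P := by
    refine Integrable.of_bound (C := 1) (Measurable.aestronglyMeasurable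
      (Finset.measurable_prod _ fun i _ => hYm.comp (measurable_pi_apply i)))
      (ae_of_all _ fun t => ?_)
    rw [Real.norm_of_nonneg (Finset.prod_nonneg fun i _ => hY0 _)]
    exact Finset.prod_le_one (fun i _ => hY0 _) fun i _ => hY1 _
  have hmarkov := mul_meas_ge_le_integral_of_nonneg
    (ae_of_all P fun t => Finset.prod_nonneg fun i (_ : i ∈ Finset.univ) => hY0 (t i)) hint
    ((1 / 2) ^ (l - 1))
  have hq0 : 0 ≤ q := measureReal_nonneg
  have hq1 : q ≤ 1 := measureReal_le_one
  rw [mul_comm] at hmarkov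
  calc _ ≤ P.real {t | (1 / 2 : ℝ) ^ (l - 1) ≤ ∏ i, Y (t i)} * (1 / 2) ^ (l - 1) := by
        refine mul_le_mul_of_nonneg_right (measureReal_mono fun t ht => ?_) (by positivity)
        simp only [Set.mem_ofPred_eq] at ht ⊢
        rw [hprod]
        exact pow_le_pow_of_le_one (by norm_num) (by norm_num) (by omega)
    _ ≤ ∫ t, ∏ i, Y (t i) ∂P := hmarkov
    _ = (1 - q / 2) ^ n := by
        rw [integral_fintype_prod_eq_prod (μ := fun _ : Fin n => μ) (fun _ => Y)]
        simp [hYint]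
    _ ≤ Real.exp (-(q / 2)) ^ n := by
        refine pow_le_pow_left₀ (by linarith) ?_ n
        linarith [Real.add_one_le_exp (-(q / 2))]
    _ = _ := by rw [← Real.exp_nat_mul]; ring_nf

namespace IsLarge

variable (h : IsLarge n)
include h

lemma exp_deviation_le : 2 * Real.exp (-2 * deviation n ^ 2 / n) * n ≤ 1 / Real.log n := by
  have hn := h.pos
  have h2 := h.two_le_log
  have h1 : -2 * deviation n ^ 2 / n = -(Real.log n + Real.log n) := by
    rw [h.sq_deviation]; field_simp; ring
  rw [h1, Real.exp_neg, Real.exp_add, Real.exp_log hn, le_div_iff₀ (by linarith)]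
  have h3 := h.two_mul_log_le
  have : 2 * ((n : ℝ) * n)⁻¹ * n * Real.log n = 2 * Real.log n / n := by field_simp
  rw [this]
  exact div_le_one_of_le₀ h3 hn.le

/-- The probability that item number `l`, if its multiplier exceeds the next one, stays unsold. -/
lemma measureReal_unsold_le [NullSingletonClass μ] {l : ℕ} (hl : 1 ≤ l) (hl' : l ≤ keptCount n) :
    (Measure.pi fun _ : Fin n => μ).real
        {t | (Finset.univ.filter fun i => breakpoint n μ l < t i).card < l} ≤
      1 / Real.log n := by
  have hn := h.pos
  have h2 := h.two_le_log
  have hd := h.deviation_pos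
  have hq := h.measureReal_Ioi_breakpoint (μ := μ) hl hl'
  rcases min_choice ((l : ℝ) / n * (2 * Real.log (Real.log n))) ((l : ℝ) / n + √(Real.log n / n))
    with hmin | hmin
  · have hT := measureReal_card_lt_le (n := n) (μ := μ) (breakpoint n μ l) (l := l)
    have hexp : Real.exp (-(n * μ.real (Set.Ioi (breakpoint n μ l)) / 2)) =
        (1 / Real.log n) ^ l := by
      rw [hq, saleProb, hmin,
        show -((n : ℝ) * ((l : ℝ) / n * (2 * Real.log (Real.log n))) / 2) =
          (l : ℕ) * (-Real.log (Real.log n)) by field_simp,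
        Real.exp_nat_mul, Real.exp_neg, Real.exp_log (by linarith), one_div]
    rw [hexp] at hT
    obtain ⟨r, rfl⟩ : ∃ r, l = r + 1 := ⟨l - 1, by omega⟩
    rw [Nat.add_sub_cancel, pow_succ] at hT
    have h3 : (1 / Real.log n) ^ r ≤ (1 / 2 : ℝ) ^ r :=
      pow_le_pow_left₀ (by positivity) (one_div_le_one_div_of_le (by norm_num) h2) r
    have h4 : (0 : ℝ) < (1 / 2 : ℝ) ^ r := by positivity
    have h5 : 0 ≤ 1 / Real.log n := by positivity
    refine le_of_mul_le_mul_right (hT.trans ?_) h4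
    rw [mul_comm]
    exact mul_le_mul_of_nonneg_left h3 h5
  · have hT := measureReal_deviation_le (μ := μ) (Finset.univ : Finset (Fin n))
      (breakpoint n μ l) hd
    have h1 := h.exp_deviation_le
    have h3 := h.one_le_cast
    refine le_trans ?_ (hT.trans (le_trans ?_ h1))
    · refine measureReal_mono fun t ht => ?_
      simp only [Set.mem_ofPred_eq] at ht ⊢
      have ht' : ((Finset.univ.filter fun i => breakpoint n μ l < t i).card : ℝ) ≤ l := by
        exact_mod_cast ht.le
      rw [countAbove_eq_card, hq, saleProb, hmin, h.sqrt_log_div, Finset.card_univ,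
        Fintype.card_fin, le_abs]
      right
      have : (n : ℝ) * ((l : ℝ) / n + deviation n / n) = l + deviation n := by field_simp
      linarith
    · exact le_mul_of_one_le_right (by positivity) h3

end IsLarge

/-- The event that, for every item, the number of buyers before buyer `i` with a type above the
breakpoint of the item is close to its mean. -/
noncomputable def regularBefore (n : ℕ) (μ : Measure ℝ) (i : Fin n) : Set (Fin n → ℝ) :=
  ⋂ k ∈ Finset.Icc 1 (keptCount n), {t | |countAbove (Finset.Iio i) (breakpoint n μ k) t -
    (Finset.Iio i).card * μ.real (Set.Ioi (breakpoint n μ k))| < deviation n}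

lemma measurableSet_regularBefore {μ : Measure ℝ} (i : Fin n) :
    MeasurableSet (regularBefore n μ i) :=
  Finset.measurableSet_biInter _ fun _ _ => measurableSet_lt
    ((measurable_countAbove _ _).sub_const _).abs measurable_const

lemma IsLarge.le_measureReal_regularBefore (h : IsLarge n) (i : Fin n) :
    1 - 1 / Real.log n ≤ (Measure.pi fun _ : Fin n => μ).real (regularBefore n μ i) := by
  set P := Measure.pi fun _ : Fin n => μ
  have hcompl : P.real (regularBefore n μ i)ᶜ ≤ 1 / Real.log n := by
    have hsub : (regularBefore n μ i)ᶜ ⊆ ⋃ k ∈ Finset.Icc 1 (keptCount n),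
        {t | deviation n ≤ |countAbove (Finset.Iio i) (breakpoint n μ k) t -
          (Finset.Iio i).card * μ.real (Set.Ioi (breakpoint n μ k))|} := fun t ht => by
      simpa [regularBefore] using ht
    have hKn : (keptCount n : ℝ) ≤ n := by exact_mod_cast keptCount_le n
    calc P.real (regularBefore n μ i)ᶜ ≤ _ := measureReal_mono hsub (measure_ne_top _ _)
      _ ≤ _ := measureReal_biUnion_finset_le _ _
      _ ≤ ∑ k ∈ Finset.Icc 1 (keptCount n), 2 * Real.exp (-2 * deviation n ^ 2 / n) :=
          Finset.sum_le_sum fun k _ => measureReal_deviation_le _ _ h.deviation_pos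
      _ = 2 * Real.exp (-2 * deviation n ^ 2 / n) * keptCount n := by
          rw [Finset.sum_const, Nat.card_Icc, nsmul_eq_mul, Nat.add_sub_cancel, mul_comm]
      _ ≤ 2 * Real.exp (-2 * deviation n ^ 2 / n) * n := by gcongr
      _ ≤ _ := h.exp_deviation_le
  rw [probReal_compl_eq_one_sub (measurableSet_regularBefore i)] at hcompl
  linarith

/-- On the regular event no long window of items has been demanded as often as it has items. -/
lemma IsLarge.card_lt_of_mem_regularBefore [NullSingletonClass μ] (h : IsLarge n) {i : Fin n}
    (hi : (i : ℝ) ≤ (1 - 1 / Real.log n) * n) {t : Fin n → ℝ} (ht : t ∈ regularBefore n μ i)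
    (hgen : ∀ i' k, t i' ≠ breakpoint n μ k) {s b : ℕ} (hsb : s < b) (hb : b ≤ keptCount n)
    (hw : window n ≤ b - s) :
    (Finset.univ.filter fun i' => i' < i ∧ breakpoint n μ b ≤ t i' ∧
      (s = 0 ∨ t i' ≤ breakpoint n μ s)).card < b - s := by
  classical
  have hn := h.pos
  have h2 := h.two_le_log
  have hreg : ∀ k, 1 ≤ k → k ≤ keptCount n →
      |countAbove (Finset.Iio i) (breakpoint n μ k) t - i * saleProb n k| < deviation n :=
    fun k hk hk' => by
      have := Set.mem_iInter₂.1 ht k (Finset.mem_Icc.2 ⟨hk, hk'⟩)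
      simpa [h.measureReal_Ioi_breakpoint (μ := μ) hk hk'] using this
  have hB := (abs_lt.1 (hreg b (by omega) hb)).2
  -- there is no breakpoint of an item with number `0`: no upper bound on the types
  have hcard : ((Finset.univ.filter fun i' => i' < i ∧ breakpoint n μ b ≤ t i' ∧
      (s = 0 ∨ t i' ≤ breakpoint n μ s)).card : ℝ) ≤
      i * (saleProb n b - (s : ℝ) / n) + 2 * deviation n := by
    rcases Nat.eq_zero_or_pos s with rfl | hs
    · have : (Finset.univ.filter fun i' => i' < i ∧ breakpoint n μ b ≤ t i' ∧
          (0 = 0 ∨ t i' ≤ breakpoint n μ 0)) =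
          (Finset.Iio i).filter fun i' => breakpoint n μ b < t i' := by
        ext i'
        simp [lt_iff_le_and_ne, (hgen i' b).symm]
      rw [this, ← countAbove_eq_card]
      have := h.deviation_pos
      simp only [Nat.cast_zero, zero_div, sub_zero]
      linarith
    · have hS := (abs_lt.1 (hreg s hs (by omega))).1
      have hanti : breakpoint n μ b ≤ breakpoint n μ s := h.breakpoint_anti hs hsb.le hb
      have : (Finset.univ.filter fun i' => i' < i ∧ breakpoint n μ b ≤ t i' ∧
          (s = 0 ∨ t i' ≤ breakpoint n μ s)) =
          ((Finset.Iio i).filter fun i' => breakpoint n μ b < t i') \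
            (Finset.Iio i).filter fun i' => breakpoint n μ s < t i' := by
        ext i'
        simp only [Finset.mem_filter, Finset.mem_univ, true_and, Finset.mem_sdiff,
          Finset.mem_Iio, not_and, not_lt, hs.ne', false_or]
        constructor
        · rintro ⟨h1, h2, h3⟩
          exact ⟨⟨h1, lt_of_le_of_ne h2 (hgen i' b).symm⟩, fun _ => h3⟩
        · rintro ⟨⟨h1, h2⟩, h3⟩
          exact ⟨h1, h2.le, h3 h1⟩
      have hsub : ((Finset.Iio i).filter fun i' => breakpoint n μ s < t i') ⊆
          (Finset.Iio i).filter fun i' => breakpoint n μ b < t i' := fun i' hi' => by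
        simp only [Finset.mem_filter] at hi' ⊢
        exact ⟨hi'.1, hanti.trans_lt hi'.2⟩
      rw [this, Finset.card_sdiff_of_subset hsub, Nat.cast_sub (Finset.card_le_card hsub),
        ← countAbove_eq_card, ← countAbove_eq_card]
      have hq := mul_le_mul_of_nonneg_left (h.div_le_saleProb s) (Nat.cast_nonneg (α := ℝ) i)
      linarith
  have hcast : ((b - s : ℕ) : ℝ) = (b : ℝ) - s := Nat.cast_sub hsb.le
  have hq : saleProb n b - (s : ℝ) / n ≤ (((b - s : ℕ) : ℝ) + deviation n) / n := by
    rw [hcast, le_div_iff₀ hn, sub_mul, div_mul_cancel₀ _ hn.ne']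
    linarith [h.saleProb_le b]
  have hd := h.deviation_pos
  have hw' : (window n : ℝ) ≤ ((b - s : ℕ) : ℝ) := by exact_mod_cast hw
  have hwin := h.deviation_lt_window
  have hδ : 0 < 1 / Real.log n := by positivity
  have hfin : (i : ℝ) * (saleProb n b - (s : ℝ) / n) ≤
      (1 - 1 / Real.log n) * (((b - s : ℕ) : ℝ) + deviation n) := by
    calc (i : ℝ) * (saleProb n b - (s : ℝ) / n)
        ≤ i * ((((b - s : ℕ) : ℝ) + deviation n) / n) := by gcongr
      _ ≤ (1 - 1 / Real.log n) * n * ((((b - s : ℕ) : ℝ) + deviation n) / n) := by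
          gcongr
      _ = _ := by field_simp
  have hlt : ((Finset.univ.filter fun i' => i' < i ∧ breakpoint n μ b ≤ t i' ∧
      (s = 0 ∨ t i' ≤ breakpoint n μ s)).card : ℝ) < ((b - s : ℕ) : ℝ) := by
    nlinarith [mul_le_mul_of_nonneg_left hw' hδ.le, mul_pos hδ hd]
  exact_mod_cast hlt

end Concentration

/-! ### Integrability, and the expected optimal welfare -/

section Integrability

variable {n m : ℕ} {α : Fin m → ℝ} {μ : Measure ℝ} [IsProbabilityMeasure μ]

/-- Almost every type differs from all breakpoints and leaves its owner indifferent only between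
options with the same multiplier. -/
lemma ae_generic {μ : Measure ℝ} [NullSingletonClass μ] (c x : ℕ → ℝ) (M : ℕ) :
    ∀ᵐ v ∂μ, (∀ k, v ≠ x k) ∧ ∀ j ≤ M, ∀ l ≤ M,
      itemUtil c x M j v = itemUtil c x M l v → itemMult c M j = itemMult c M l := by
  refine Filter.Eventually.and (ae_all_iff.2 fun k => by simp [ae_iff]) ?_
  refine ae_all_iff.2 fun j => ae_all_iff.2 fun _ => ae_all_iff.2 fun l => ae_all_iff.2 fun _ => ?_
  by_cases hjl : itemMult c M j = itemMult c M l
  · exact ae_of_all _ fun _ _ => hjl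
  refine measure_mono_null (fun v hv => ?_) (measure_singleton
    ((itemPrice c x M j - itemPrice c x M l) / (itemMult c M j - itemMult c M l)))
  simp only [Set.mem_compl_iff, Set.mem_ofPred_eq, hjl, imp_false, not_not] at hv
  rw [Set.mem_singleton_iff, eq_div_iff (sub_ne_zero.2 hjl)]
  have h1 := itemMult_mul (c := c) (x := x) (M := M) j v
  have h2 := itemMult_mul (c := c) (x := x) (M := M) l v
  linarith

lemma measurable_itemUtil (c x : ℕ → ℝ) (M j : ℕ) : Measurable (itemUtil c x M j) := by
  unfold itemUtil
  split_ifs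
  · exact measurable_const
  · fun_prop

/-- Tie-breaking may depend on the types in a non-measurable way, but it affects the welfare on a
null set only. -/
lemma aestronglyMeasurable_welfare [NullSingletonClass μ] (hα : ∀ j, 0 ≤ α j) (hanti : Antitone α)
    {a : (Fin n → ℝ) → Fin n → Option (Fin m)}
    (ha : ∀ t, IsOutcome (separableValue α t) (staticPrice n μ α) (a t)) :
    AEStronglyMeasurable (fun t => welfare (separableValue α t) (a t))
      (Measure.pi fun _ : Fin n => μ) := by
  set P := Measure.pi fun _ : Fin n => μ
  set M := min m (keptCount n)
  set c := multDrop n α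
  set x := breakpoint n μ
  let O : (Fin n → Option (Fin m)) → Set (Fin n → ℝ) :=
    fun b => {t | IsSale c x M t fun i => itemNumber (b i)}
  have hO : ∀ b, MeasurableSet (O b) := fun b => by
    have : O b = {_t | (∀ i, itemNumber (b i) ≤ M) ∧
        ∀ i i', itemNumber (b i) ≠ 0 → itemNumber (b i) = itemNumber (b i') → i = i'} ∩
        ⋂ i, ⋂ l, {t | l ≤ M → (l = 0 ∨ ∀ i' < i, itemNumber (b i') ≠ l) →
          itemUtil c x M l (t i) ≤ itemUtil c x M (itemNumber (b i)) (t i)} := by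
      ext t
      simp only [O, Set.mem_ofPred_eq, Set.mem_inter_iff, Set.mem_iInter]
      exact ⟨fun h => ⟨⟨h.le, h.inj⟩, h.best⟩, fun h => ⟨h.1.1, h.1.2, h.2⟩⟩
    rw [this]
    refine (MeasurableSet.const _).inter (MeasurableSet.iInter fun i => MeasurableSet.iInter
      fun l => (MeasurableSet.const _).imp ((MeasurableSet.const _).imp (measurableSet_le ?_ ?_)))
    · exact (measurable_itemUtil c x M _).comp (measurable_pi_apply i)
    · exact (measurable_itemUtil c x M _).comp (measurable_pi_apply i)
  have hcover : ⋃ b, O b = Set.univ :=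
    Set.eq_univ_of_forall fun t => Set.mem_iUnion.2 ⟨a t, (ha t).isSale⟩
  rw [← Measure.restrict_univ (μ := P), ← hcover, aestronglyMeasurable_iUnion_iff]
  intro b
  have hmeas : Measurable fun t : Fin n → ℝ => ∑ i, itemMult c M (itemNumber (b i)) * t i := by
    fun_prop
  refine hmeas.aestronglyMeasurable.congr ?_
  filter_upwards [ae_restrict_mem (hO b), ae_restrict_of_ae (ae_pi_of_ae (ae_generic c x M))]
    with t hb hgen
  rw [(ha t).welfare_eq]
  refine Finset.sum_congr rfl fun i _ => ?_
  rw [IsSale.itemMult_eq hb (ha t).isSale (fun k hk => multDrop_nonneg hα hanti hk)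
    (fun i => (hgen i).2) i]

lemma IsOutcome.isMatching {v : Fin n → Fin m → ℝ} {p : Fin m → EReal}
    {a : Fin n → Option (Fin m)} (h : IsOutcome v p a) : IsMatching a := fun i i' j hi hi' => by
  rcases lt_trichotomy i i' with hlt | heq | hlt
  · exact absurd hi ((h.of_some i' j hi').1 i hlt)
  · exact heq
  · exact absurd hi' ((h.of_some i j hi).1 i' hlt)

lemma welfare_nonneg (hα : ∀ j, 0 ≤ α j) {t : Fin n → ℝ} (ht : ∀ i, 0 ≤ t i)
    (a : Fin n → Option (Fin m)) : 0 ≤ welfare (separableValue α t) a := by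
  refine Finset.sum_nonneg fun i _ => ?_
  rcases a i with _ | j
  · exact le_rfl
  · exact mul_nonneg (hα j) (ht i)

lemma welfare_le_optWelfare {v : Fin n → Fin m → ℝ} {a : Fin n → Option (Fin m)}
    (ha : IsMatching a) : welfare v a ≤ optWelfare v :=
  le_ciSup (f := fun a : {a : Fin n → Option (Fin m) // IsMatching a} => welfare v a.1)
    (Set.finite_range _).bddAbove ⟨a, ha⟩

lemma measurable_welfare (a : Fin n → Option (Fin m)) :
    Measurable fun t => welfare (separableValue α t) a := by
  refine Finset.measurable_sum _ fun i _ => ?_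
  rcases a i with _ | j
  · exact measurable_const
  · exact measurable_const.mul (measurable_pi_apply i)

lemma integrable_eval_excess (hi : Integrable (fun t => t) μ) (i : Fin n) (y : ℝ) :
    Integrable (fun t : Fin n → ℝ => max (t i - y) 0) (Measure.pi fun _ : Fin n => μ) :=
  integrable_comp_eval (μ := fun _ : Fin n => μ) (integrable_excess hi y)

lemma ae_nonneg_pi (hμ : IsMHR μ) :
    ∀ᵐ t ∂(Measure.pi fun _ : Fin n => μ), ∀ i, 0 ≤ t i := ae_pi_of_ae hμ.nonneg

lemma integrable_optWelfare (hμ : IsMHR μ) (hα : ∀ j, 0 ≤ α j) (hanti : Antitone α)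
    (hK : 1 ≤ keptCount n) :
    Integrable (fun t => optWelfare (separableValue α t)) (Measure.pi fun _ : Fin n => μ) := by
  have hmeas : Measurable fun t : Fin n → ℝ => optWelfare (separableValue α t) :=
    Measurable.iSup fun a => measurable_welfare a.1
  have hdom : Integrable (fun t : Fin n → ℝ => ∑ k ∈ Finset.Icc 1 (min m (keptCount n)),
      multDrop n α k * ((n : ℝ) / keptCount n * (k * 0) + ∑ i, max (t i - 0) 0))
      (Measure.pi fun _ : Fin n => μ) :=
    integrable_finsetSum _ fun k _ => ((integrable_const _).add
      (integrable_finsetSum _ fun i _ => integrable_eval_excess hμ.integrable_id i 0)).const_mul _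
  refine hdom.mono' hmeas.aestronglyMeasurable ?_
  filter_upwards [ae_nonneg_pi hμ] with t ht
  rw [Real.norm_of_nonneg]
  · exact optWelfare_le hα hanti hK ht (y := fun _ => 0) fun _ => le_rfl
  · exact (welfare_nonneg hα ht (fun _ => none)).trans
      (welfare_le_optWelfare fun _ _ _ h => by simp at h)

lemma integrable_welfare (hμ : IsMHR μ) (hα : ∀ j, 0 ≤ α j) (hanti : Antitone α)
    (hK : 1 ≤ keptCount n) {a : (Fin n → ℝ) → Fin n → Option (Fin m)}
    (ha : ∀ t, IsOutcome (separableValue α t) (staticPrice n μ α) (a t)) :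
    Integrable (fun t => welfare (separableValue α t) (a t)) (Measure.pi fun _ : Fin n => μ) := by
  have := hμ.nullSingletonClass
  refine (integrable_optWelfare hμ hα hanti hK).mono'
    (aestronglyMeasurable_welfare hα hanti ha) ?_
  filter_upwards [ae_nonneg_pi hμ] with t ht
  rw [Real.norm_of_nonneg (welfare_nonneg hα ht _)]
  exact welfare_le_optWelfare (ha t).isMatching

lemma integral_optWelfare_le (hμ : IsMHR μ) (hα : ∀ j, 0 ≤ α j) (hanti : Antitone α)
    (hK : 1 ≤ keptCount n) {y : ℕ → ℝ} (hy : ∀ k, 0 ≤ y k) :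
    ∫ t, optWelfare (separableValue α t) ∂(Measure.pi fun _ : Fin n => μ) ≤
      (n : ℝ) / keptCount n * ∑ k ∈ Finset.Icc 1 (min m (keptCount n)),
        multDrop n α k * (k * y k + n * meanExcess μ (y k)) := by
  have hex := fun k => integrable_finsetSum (Finset.univ : Finset (Fin n)) fun i _ =>
    integrable_eval_excess hμ.integrable_id i (y k)
  have hterm : ∀ k, Integrable (fun t : Fin n → ℝ => multDrop n α k *
      ((n : ℝ) / keptCount n * (k * y k) + ∑ i, max (t i - y k) 0))
      (Measure.pi fun _ : Fin n => μ) := fun k =>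
    ((integrable_const ((n : ℝ) / keptCount n * (k * y k))).add (hex k)).const_mul _
  have hint := integrable_finsetSum (Finset.Icc 1 (min m (keptCount n))) fun k _ => hterm k
  have hKpos : (0 : ℝ) < keptCount n := by exact_mod_cast hK
  have hρ : 1 ≤ (n : ℝ) / keptCount n := by
    rw [one_le_div hKpos]
    exact_mod_cast keptCount_le n
  calc _ ≤ ∫ t, ∑ k ∈ Finset.Icc 1 (min m (keptCount n)), multDrop n α k *
          ((n : ℝ) / keptCount n * (k * y k) + ∑ i, max (t i - y k) 0)
          ∂(Measure.pi fun _ : Fin n => μ) := by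
        refine integral_mono_ae (integrable_optWelfare hμ hα hanti hK) hint ?_
        filter_upwards [ae_nonneg_pi hμ] with t ht
        exact optWelfare_le hα hanti hK ht hy
    _ = ∑ k ∈ Finset.Icc 1 (min m (keptCount n)), multDrop n α k *
          ((n : ℝ) / keptCount n * (k * y k) + n * meanExcess μ (y k)) := by
        rw [integral_finsetSum _ fun k _ => hterm k]
        refine Finset.sum_congr rfl fun k _ => ?_
        rw [integral_const_mul, integral_add (integrable_const _) (hex k), integral_const,
          integral_finsetSum _ fun i _ => integrable_eval_excess hμ.integrable_id i (y k)]
        simp only [probReal_univ, one_smul]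
        congr 2
        rw [Finset.sum_congr rfl fun i _ => integral_comp_eval (μ := fun _ : Fin n => μ)
          (integrable_excess hμ.integrable_id (y k)).aestronglyMeasurable]
        simp [meanExcess]
    _ ≤ _ := by
        rw [Finset.mul_sum]
        refine Finset.sum_le_sum fun k hk => ?_
        rw [mul_left_comm ((n : ℝ) / keptCount n) (multDrop n α k), mul_add ((n : ℝ) / keptCount n)]
        refine mul_le_mul_of_nonneg_left ?_ (multDrop_nonneg hα hanti (Finset.mem_Icc.1 hk).1)
        exact add_le_add le_rfl
          (le_mul_of_one_le_left (mul_nonneg (Nat.cast_nonneg n) (meanExcess_nonneg _)) hρ)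

end Integrability

/-! ### The expected welfare of the mechanism -/

section LowerBound

/-- Every item with a nonzero price belongs to a class of equal multipliers with a last item. -/
lemma exists_last_of_mult {c x : ℕ → ℝ} {M j : ℕ} (hc : ∀ k, 1 ≤ k → 0 ≤ c k) (hj : 1 ≤ j) :
    itemPrice c x M j = 0 ∨
      ∃ l, j ≤ l ∧ l ≤ M ∧ (∀ r, j ≤ r → r < l → c r = 0) ∧ 0 < c l := by
  classical
  by_cases hex : ∃ l, j ≤ l ∧ l ≤ M ∧ 0 < c l
  · obtain ⟨h1, h2, h3⟩ := Nat.find_spec hex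
    refine Or.inr ⟨Nat.find hex, h1, h2, fun r hr hr' => ?_, h3⟩
    exact le_antisymm (not_lt.1 fun hcr => Nat.find_min hex hr' ⟨hr, by omega, hcr⟩)
      (hc r (by omega))
  · push Not at hex
    refine Or.inl ?_
    rw [itemPrice, if_neg (by omega)]
    refine Finset.sum_eq_zero fun k hk => ?_
    rw [Finset.mem_Ico] at hk
    rw [le_antisymm (hex k hk.1 (by omega)) (hc k (by omega)), zero_mul]

lemma sum_itemPrice (c x : ℕ → ℝ) (M : ℕ) :
    ∑ j ∈ Finset.Icc 1 M, itemPrice c x M j = ∑ k ∈ Finset.Icc 1 M, c k * (k * x k) := by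
  have h1 : ∀ j ∈ Finset.Icc 1 M,
      itemPrice c x M j = ∑ k ∈ Finset.Ico j (M + 1), c k * x k := fun j hj => by
    rw [Finset.mem_Icc] at hj
    rw [itemPrice, if_neg (by omega)]
  rw [Finset.sum_congr rfl h1, Finset.sum_comm' (t' := Finset.Icc 1 M)
    (s' := fun k => Finset.Icc 1 k)]
  · refine Finset.sum_congr rfl fun k _ => ?_
    rw [Finset.sum_const, Nat.card_Icc, nsmul_eq_mul, Nat.add_sub_cancel]
    ring
  · intro j k
    simp only [Finset.mem_Icc, Finset.mem_Ico]
    omega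

variable {n m : ℕ} {α : Fin m → ℝ} {μ : Measure ℝ} [IsProbabilityMeasure μ]

lemma measurable_windowUtil (c x : ℕ → ℝ) (M w : ℕ) : Measurable (windowUtil c x M w) :=
  Finset.measurable_sum _ fun k _ =>
    ((measurable_id.sub_const (x k)).indicator measurableSet_Ioi).const_mul (c k)

lemma integrable_windowUtil (hi : Integrable (fun t => t) μ) (c x : ℕ → ℝ) (M w : ℕ) :
    Integrable (windowUtil c x M w) μ :=
  integrable_finsetSum _ fun k _ => (integrable_truncExcess hi (x k) (x (k - w))).const_mul (c k)

lemma integral_windowUtil (hi : Integrable (fun t => t) μ) (c x : ℕ → ℝ) (M w : ℕ) :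
    ∫ v, windowUtil c x M w v ∂μ =
      ∑ k ∈ Finset.Ioc w M, c k * truncExcess μ (x k) (x (k - w)) := by
  simp only [windowUtil]
  rw [integral_finsetSum _ fun k _ =>
    (integrable_truncExcess hi (x k) (x (k - w))).const_mul (c k)]
  exact Finset.sum_congr rfl fun k _ => integral_const_mul _ _

lemma truncExcess_nonneg {μ : Measure ℝ} {x z : ℝ} (hxz : x ≤ z) : 0 ≤ truncExcess μ x z :=
  integral_nonneg fun t => Set.indicator_nonneg (fun v hv => by
    have : z < v := hv
    linarith) t

/-- The types of the earlier buyers are independent of the type of buyer `i`. -/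
lemma integral_indicator_regularBefore (i : Fin n) {g : ℝ → ℝ} (hg : Measurable g) :
    ∫ t, (regularBefore n μ i).indicator (fun t => g (t i)) t
        ∂(Measure.pi fun _ : Fin n => μ) =
      (Measure.pi fun _ : Fin n => μ).real (regularBefore n μ i) * ∫ v, g v ∂μ := by
  classical
  set P := Measure.pi fun _ : Fin n => μ
  have hindep : iIndepFun (fun (i : Fin n) (t : Fin n → ℝ) => t i) P :=
    iIndepFun_pi (X := fun _ v => v) fun _ => aemeasurable_id
  have h2 := hindep.indepFun_finset (Finset.Iio i) {i} (by simp)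
    fun i => measurable_pi_apply i
  let ext : (Finset.Iio i → ℝ) → Fin n → ℝ := fun u i' =>
    if h : i' ∈ Finset.Iio i then u ⟨i', h⟩ else 0
  have hext : Measurable ext := by
    refine measurable_pi_lambda _ fun i' => ?_
    by_cases h : i' ∈ Finset.Iio i
    · simp only [ext, dif_pos h]
      exact measurable_pi_apply _
    · simp only [ext, dif_neg h]
      exact measurable_const
  have hmem : ∀ t : Fin n → ℝ,
      ext (fun i' => t i') ∈ regularBefore n μ i ↔ t ∈ regularBefore n μ i := fun t => by
    have hcount : ∀ x, countAbove (Finset.Iio i) x (ext fun i' => t i') =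
        countAbove (Finset.Iio i) x t := fun x =>
      Finset.sum_congr rfl fun i' hi' => by simp only [ext, dif_pos hi']
    simp only [regularBefore, Set.mem_iInter, Set.mem_ofPred_eq, hcount]
  have hGm := measurableSet_regularBefore (μ := μ) i
  have hgi : Measurable fun u : (({i} : Finset (Fin n)) → ℝ) =>
      g (u ⟨i, Finset.mem_singleton_self i⟩) :=
    hg.comp (measurable_pi_apply (⟨i, Finset.mem_singleton_self i⟩ : ({i} : Finset (Fin n))))
  have h3 := h2.integral_fun_comp_mul_comp
    (f := fun u => (regularBefore n μ i).indicator (1 : (Fin n → ℝ) → ℝ) (ext u))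
    (g := fun u => g (u ⟨i, Finset.mem_singleton_self i⟩))
    (measurable_pi_lambda _ fun i' => measurable_pi_apply _).aemeasurable
    (measurable_pi_lambda _ fun i' => measurable_pi_apply _).aemeasurable
    ((measurable_one.indicator hGm).comp hext).aestronglyMeasurable
    hgi.aestronglyMeasurable
  have hind : ∀ t : Fin n → ℝ,
      (regularBefore n μ i).indicator (1 : (Fin n → ℝ) → ℝ) (ext fun i' => t i') =
        (regularBefore n μ i).indicator 1 t := fun t => by
    simp only [Set.indicator_apply, hmem, Pi.one_apply]
  simp only [hind] at h3
  rw [integral_indicator_one hGm,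
    integral_comp_eval (μ := fun _ : Fin n => μ) hg.aestronglyMeasurable] at h3
  rw [← h3]
  refine integral_congr_ae (ae_of_all _ fun t => ?_)
  simp only [Set.indicator_apply, Pi.one_apply]
  split_ifs <;> simp

lemma le_card_filter_le {r : ℝ} (hr : r ≤ n) :
    r ≤ (Finset.univ.filter fun i : Fin n => (i : ℝ) ≤ r).card := by
  have h1 : (Finset.univ.filter fun i : Fin n => (i : ℕ) < ⌈r⌉₊) ⊆
      Finset.univ.filter fun i : Fin n => (i : ℝ) ≤ r := fun i hi => by
    simp only [Finset.mem_filter, Finset.mem_univ, true_and] at hi ⊢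
    exact (Nat.lt_ceil.1 hi).le
  have h2 := Finset.card_le_card h1
  rw [Fin.card_filter_val_lt, min_eq_right (Nat.ceil_le.2 hr)] at h2
  exact (Nat.le_ceil r).trans (by exact_mod_cast h2)

/-- The expected welfare is at least the revenue from selling all items plus the utility that
buyers obtain when no window of items is sold out, up to factors that tend to one. -/
lemma IsLarge.le_integral_welfare (h : IsLarge n) (hμ : IsMHR μ) (hα : ∀ j, 0 ≤ α j)
    (hanti : Antitone α) {a : (Fin n → ℝ) → Fin n → Option (Fin m)}
    (ha : ∀ t, IsOutcome (separableValue α t) (staticPrice n μ α) (a t)) :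
    (1 - 1 / Real.log n) * ∑ k ∈ Finset.Icc 1 (min m (keptCount n)),
        multDrop n α k * (k * breakpoint n μ k) +
      (1 - 1 / Real.log n) ^ 2 * (n * ∑ k ∈ Finset.Ioc (window n) (min m (keptCount n)),
        multDrop n α k * truncExcess μ (breakpoint n μ k) (breakpoint n μ (k - window n))) ≤
      ∫ t, welfare (separableValue α t) (a t) ∂(Measure.pi fun _ : Fin n => μ) := by
  classical
  have := hμ.nullSingletonClass
  have hi := hμ.integrable_id
  set P := Measure.pi fun _ : Fin n => μ
  set M := min m (keptCount n) with hM
  set c := multDrop n α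
  set x := breakpoint n μ with hxdef
  set w := window n
  set δ := 1 / Real.log n with hδ
  have hMK : M ≤ keptCount n := min_le_right _ _
  have h2 := h.two_le_log
  have hδ0 : 0 < δ := by positivity
  have hδ1 : δ ≤ 1 / 2 := one_div_le_one_div_of_le (by norm_num) h2
  have hn := h.pos
  have hc : ∀ k, 1 ≤ k → 0 ≤ c k := fun k hk => multDrop_nonneg hα hanti hk
  have hx : ∀ k l, 1 ≤ k → k ≤ l → l ≤ M → x l ≤ x k := fun k l h1 h2 h3 =>
    h.breakpoint_anti h1 h2 (h3.trans hMK)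
  have hx0 : ∀ k, 1 ≤ k → k ≤ M → 0 ≤ x k := fun k h1 h2 =>
    (h.breakpoint_pos hμ.nonneg h1 (h2.trans hMK)).le
  -- the events on which the single items are sold
  have hsold : ∀ j ∈ Finset.Icc 1 M, ∃ E : Set (Fin n → ℝ), MeasurableSet E ∧ 1 - δ ≤ P.real E ∧
      ∀ t ∈ E, ∀ o, IsSale c x M t o → itemPrice c x M j ≠ 0 → ∃ i, o i = j := fun j hj => by
    rw [Finset.mem_Icc] at hj
    rcases exists_last_of_mult (x := x) (M := M) hc hj.1 with h0 | ⟨l, hl1, hl2, hl3, hl4⟩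
    · exact ⟨Set.univ, MeasurableSet.univ, by simp [hδ0.le], fun t _ o _ hp => absurd h0 hp⟩
    · have hmeas : MeasurableSet
          {t : Fin n → ℝ | (Finset.univ.filter fun i => x l < t i).card < l} := by
        have : {t : Fin n → ℝ | (Finset.univ.filter fun i => x l < t i).card < l} =
            {t | countAbove Finset.univ (x l) t < l} := by
          ext t
          simp [countAbove_eq_card]
        rw [this]
        exact measurableSet_lt (measurable_countAbove _ _) measurable_const
      refine ⟨_, hmeas.compl, ?_, fun t ht o ho _ => ?_⟩
      · rw [probReal_compl_eq_one_sub hmeas]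
        linarith [h.measureReal_unsold_le (μ := μ) (l := l) (by omega) (by omega)]
      · exact ho.exists_eq hc hx hj.1 hl1 hl2 hl3 hl4 (not_lt.1 ht)
  choose! E hEm hEP hEs using hsold
  set I := Finset.univ.filter fun i : Fin n => (i : ℝ) ≤ (1 - δ) * n with hI
  set W := windowUtil c x M w with hW
  have hWm : Measurable W := measurable_windowUtil c x M w
  have hWi : Integrable W μ := integrable_windowUtil hi c x M w
  have hWint : ∫ v, W v ∂μ = ∑ k ∈ Finset.Ioc w M, c k * truncExcess μ (x k) (x (k - w)) :=
    integral_windowUtil hi c x M w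
  have hWnn : 0 ≤ ∫ v, W v ∂μ := by
    rw [hWint]
    refine Finset.sum_nonneg fun k hk => ?_
    rw [Finset.mem_Ioc] at hk
    exact mul_nonneg (hc k (by omega))
      (truncExcess_nonneg (hx _ _ (by omega) (by omega) hk.2))
  have hrev_int : ∀ j ∈ Finset.Icc 1 M,
      Integrable ((E j).indicator fun _ => itemPrice c x M j) P := fun j hj =>
    (integrable_const _).indicator (hEm j hj)
  have hutil_int : ∀ i ∈ I,
      Integrable ((regularBefore n μ i).indicator fun t => W (t i)) P := fun i _ =>
    (integrable_comp_eval (μ := fun _ : Fin n => μ) hWi).indicator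
      (measurableSet_regularBefore i)
  have hpoint : ∀ᵐ t ∂P,
      (∑ j ∈ Finset.Icc 1 M, (E j).indicator (fun _ => itemPrice c x M j) t) +
        ∑ i ∈ I, (regularBefore n μ i).indicator (fun t => W (t i)) t ≤
      welfare (separableValue α t) (a t) := by
    filter_upwards [ae_pi_of_ae (n := n) (ae_generic (μ := μ) c x M)] with t hgen
    have hsale := (ha t).isSale
    rw [(ha t).welfare_eq]
    have hbound := sum_price_add_sum_util_le (c := c) (x := x) (M := M) (t := t) hc hx0
      ((Finset.Icc 1 M).filter fun j => t ∈ E j ∧ itemPrice c x M j ≠ 0)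
      (fun j hj => by
        rw [Finset.mem_filter] at hj
        exact hEs j hj.1 t hj.2.1 _ hsale hj.2.2)
      (fun i => if i ∈ I then (regularBefore n μ i).indicator (fun t => W (t i)) t else 0)
      (fun i => by
        have hnonneg : 0 ≤ itemUtil c x M (itemNumber (a t i)) (t i) := by
          have := hsale.best i 0 (Nat.zero_le _) (Or.inl rfl)
          rwa [itemUtil_zero] at this
        split_ifs with hiI
        · by_cases hreg : t ∈ regularBefore n μ i
          · rw [Set.indicator_of_mem hreg]
            refine hsale.windowUtil_le hc hx h.one_le_window fun k hwk hk hck => ?_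
            refine hsale.exists_available hc hx h.one_le_window (fun s b hsb hb hws => ?_)
              hwk hk hck
            exact h.card_lt_of_mem_regularBefore (Finset.mem_filter.1 hiI).2 hreg
              (fun i' => (hgen i').1) hsb (hb.trans hMK) hws
          · rw [Set.indicator_of_notMem hreg]
            exact hnonneg
        · exact hnonneg)
    refine le_trans (le_of_eq ?_) hbound
    congr 1
    · rw [Finset.sum_filter]
      refine Finset.sum_congr rfl fun j _ => ?_
      rw [Set.indicator_apply]
      by_cases h1 : t ∈ E j <;> by_cases h2 : itemPrice c x M j = 0 <;> simp [h1, h2]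
    · simp
  calc _ ≤ ∑ j ∈ Finset.Icc 1 M, P.real (E j) * itemPrice c x M j +
        ∑ i ∈ I, P.real (regularBefore n μ i) * ∫ v, W v ∂μ := by
        refine add_le_add ?_ ?_
        · rw [← sum_itemPrice, Finset.mul_sum]
          exact Finset.sum_le_sum fun j hj =>
            mul_le_mul_of_nonneg_right (hEP j hj) (itemPrice_nonneg hc hx0 j)
        · have hcard : (1 - δ) * n ≤ I.card := le_card_filter_le (by nlinarith)
          calc (1 - δ) ^ 2 * (n * ∑ k ∈ Finset.Ioc w M, c k * truncExcess μ (x k) (x (k - w)))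
              = (1 - δ) * n * ((1 - δ) * ∫ v, W v ∂μ) := by rw [hWint]; ring
            _ ≤ I.card * ((1 - δ) * ∫ v, W v ∂μ) :=
                mul_le_mul_of_nonneg_right hcard (mul_nonneg (by linarith) hWnn)
            _ = ∑ i ∈ I, (1 - δ) * ∫ v, W v ∂μ := by rw [Finset.sum_const, nsmul_eq_mul]
            _ ≤ _ := Finset.sum_le_sum fun i _ =>
                mul_le_mul_of_nonneg_right (h.le_measureReal_regularBefore i) hWnn
    _ = ∫ t, ((∑ j ∈ Finset.Icc 1 M, (E j).indicator (fun _ => itemPrice c x M j) t) +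
        ∑ i ∈ I, (regularBefore n μ i).indicator (fun t => W (t i)) t) ∂P := by
        rw [integral_add (integrable_finsetSum _ hrev_int) (integrable_finsetSum _ hutil_int),
          integral_finsetSum _ hrev_int, integral_finsetSum _ hutil_int]
        congr 1
        · refine Finset.sum_congr rfl fun j hj => ?_
          rw [integral_indicator_const _ (hEm j hj), smul_eq_mul]
        · exact Finset.sum_congr rfl fun i _ => (integral_indicator_regularBefore i hWm).symm
    _ ≤ _ := integral_mono_ae
        ((integrable_finsetSum _ hrev_int).add (integrable_finsetSum _ hutil_int))
        (integrable_welfare hμ hα hanti h.one_le_keptCount ha) hpoint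

end LowerBound

/-! ### Comparison item by item -/

section Comparison

variable {n : ℕ} {μ : Measure ℝ} [IsProbabilityMeasure μ]

/-- For few items, the revenue at a breakpoint is already close to the optimum. -/
lemma IsLarge.exists_le_revenue (h : IsLarge n) (hμ : IsMHR μ) {k : ℕ} (hk : 1 ≤ k)
    (hk' : k ≤ keptCount n) (hsmall : (k : ℝ) < (n : ℝ) ^ (7 / 8 : ℝ)) :
    ∃ y, 0 ≤ y ∧
      (1 - 25 * (Real.log (Real.log (Real.log n)) / Real.log n)) *
        (k * y + n * meanExcess μ y) ≤
      (1 - 1 / Real.log n) * (k * breakpoint n μ k) := by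
  have := hμ.nullSingletonClass
  have hn := h.pos
  have hkpos : (0 : ℝ) < k := by exact_mod_cast hk
  have h2 := h.two_le_log
  have hlll := h.one_le_logloglog
  have hll := h.one_le_loglog
  have hx := h.breakpoint_pos (μ := μ) hμ.nonneg hk hk'
  obtain ⟨y, hy0, hy⟩ := hμ.exists_le_mul hx (h.measureReal_Ioi_breakpoint hk hk')
    (h.saleProb_pos hk) (h.saleProb_lt_one hk') (by positivity) (h.div_le_saleProb k)
    (h.log_saleProb_le hk)
  refine ⟨y, hy0, ?_⟩
  set B := k * y + n * meanExcess μ y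
  set ℓ := -Real.log ((k : ℝ) / n) with hℓ
  set δ := 1 / Real.log n with hδ
  set lam := Real.log (Real.log (Real.log n))
  have hB : 0 ≤ B := add_nonneg (by positivity) (mul_nonneg hn.le (meanExcess_nonneg y))
  have hℓge : Real.log n / 8 ≤ ℓ := by
    have h3 : Real.log k ≤ 7 / 8 * Real.log n := by
      rw [← Real.log_rpow hn]
      exact Real.log_le_log hkpos hsmall.le
    rw [hℓ, Real.log_div hkpos.ne' hn.ne']
    linarith
  have hl : Real.log (2 * Real.log (Real.log n)) ≤ 1 + lam := by
    rw [Real.log_mul (by norm_num) (by linarith)]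
    linarith [Real.log_two_lt_d9]
  have hmul : (ℓ - (1 + lam)) * B ≤ (1 + ℓ) * (k * breakpoint n μ k) := by
    have hy' := mul_le_mul_of_nonneg_left hy hn.le
    have e1 : (n : ℝ) * ((-Real.log ((k : ℝ) / n) - Real.log (2 * Real.log (Real.log n))) *
        ((k : ℝ) / n * y + meanExcess μ y)) =
        (ℓ - Real.log (2 * Real.log (Real.log n))) * B := by
      simp only [B, hℓ]; field_simp
    have e2 : (n : ℝ) * ((1 - Real.log ((k : ℝ) / n)) * ((k : ℝ) / n * breakpoint n μ k)) =
        (1 + ℓ) * (k * breakpoint n μ k) := by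
      simp only [hℓ]; field_simp; ring
    rw [e1, e2] at hy'
    exact le_trans (mul_le_mul_of_nonneg_right (by linarith) hB) hy'
  have hδ0 : 0 < δ := by positivity
  have hδ1 : δ ≤ 1 / 2 := one_div_le_one_div_of_le (by norm_num) h2
  have hlogδ : Real.log n * δ = 1 := by rw [hδ]; field_simp
  have hℓδ : 1 ≤ 8 * δ * (1 + ℓ) := by nlinarith
  -- `(ℓ - 1 - lam) / (1 + ℓ) = 1 - (2 + lam) / (1 + ℓ)` and `1 / (1 + ℓ) ≤ 8 * δ`
  have hrev : (1 - 8 * δ * (2 + lam)) * B ≤ k * breakpoint n μ k := by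
    have hpos : 0 < 1 + ℓ := by linarith
    refine le_of_mul_le_mul_left ?_ hpos
    refine le_trans ?_ hmul
    have : (1 + ℓ) * (1 - 8 * δ * (2 + lam)) ≤ ℓ - (1 + lam) := by nlinarith
    calc (1 + ℓ) * ((1 - 8 * δ * (2 + lam)) * B)
        = (1 + ℓ) * (1 - 8 * δ * (2 + lam)) * B := by ring
      _ ≤ _ := mul_le_mul_of_nonneg_right this hB
  calc (1 - 25 * (lam / Real.log n)) * B = (1 - 25 * (lam * δ)) * B := by
        rw [hδ, mul_one_div]
    _ ≤ ((1 - δ) * (1 - 8 * δ * (2 + lam))) * B := by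
        refine mul_le_mul_of_nonneg_right ?_ hB
        nlinarith [mul_nonneg (mul_nonneg hδ0.le hδ0.le) (by linarith : 0 ≤ 2 + lam),
          mul_nonneg hδ0.le (sub_nonneg.2 hlll)]
    _ = (1 - δ) * ((1 - 8 * δ * (2 + lam)) * B) := by ring
    _ ≤ _ := mul_le_mul_of_nonneg_left hrev (by linarith)

/-- For many items, revenue and utility together are close to the optimum. -/
lemma IsLarge.le_revenue_add_utility (h : IsLarge n) (hμ : IsMHR μ) {k : ℕ}
    (hk' : k ≤ keptCount n) (hlarge : (n : ℝ) ^ (7 / 8 : ℝ) ≤ k) :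
    window n < k ∧
    (1 - 25 * (Real.log (Real.log (Real.log n)) / Real.log n)) *
        (k * breakpoint n μ k + n * meanExcess μ (breakpoint n μ k)) ≤
      (1 - 1 / Real.log n) * (k * breakpoint n μ k) + (1 - 1 / Real.log n) ^ 2 *
        (n * truncExcess μ (breakpoint n μ k) (breakpoint n μ (k - window n))) := by
  have := hμ.nullSingletonClass
  have hn := h.pos
  have h2 := h.two_le_log
  have hlll := h.one_le_logloglog
  have hkpos : (0 : ℝ) < k := (Real.rpow_pos_of_pos hn _).trans_le hlarge
  have hk : 1 ≤ k := by exact_mod_cast hkpos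
  have hw := h.window_le hlarge
  set δ := 1 / Real.log n with hδ
  set lam := Real.log (Real.log (Real.log n))
  have hδ0 : 0 < δ := by positivity
  have hδ1 : δ ≤ 1 / 2 := one_div_le_one_div_of_le (by norm_num) h2
  have hwk : window n < k := by
    have : (window n : ℝ) < k := by nlinarith
    exact_mod_cast this
  refine ⟨hwk, ?_⟩
  set x := breakpoint n μ k
  set z := breakpoint n μ (k - window n)
  have hx : 0 < x := h.breakpoint_pos hμ.nonneg hk hk'
  have hxz : x ≤ z := h.breakpoint_anti (by omega) (by omega) hk'
  have hR := meanExcess_nonneg (μ := μ) x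
  have hT : (1 - δ) * meanExcess μ x ≤ truncExcess μ x z := by
    have h1 := meanExcess_mul_le_truncExcess_mul hμ.integrable_id hxz
    rw [h.measureReal_Ioi_breakpoint hk hk',
      h.measureReal_Ioi_breakpoint (k := k - window n) (by omega) (by omega)] at h1
    have hq := h.saleProb_pos hk
    have h3 : (1 - δ) * saleProb n k ≤ saleProb n (k - window n) := by
      refine le_trans (mul_le_mul_of_nonneg_right ?_ hq.le) (h.sub_mul_saleProb_le hwk.le)
      have : (window n : ℝ) / k ≤ δ := (div_le_iff₀ hkpos).2 hw
      linarith
    refine le_of_mul_le_mul_right (le_trans ?_ h1) hq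
    calc (1 - δ) * meanExcess μ x * saleProb n k
        = meanExcess μ x * ((1 - δ) * saleProb n k) := by ring
      _ ≤ _ := mul_le_mul_of_nonneg_left h3 hR
  have hcoef : 1 - 25 * (lam / Real.log n) ≤ (1 - δ) ^ 3 := by
    have : lam / Real.log n = lam * δ := by rw [hδ, mul_one_div]
    rw [this]
    nlinarith [mul_nonneg hδ0.le (sub_nonneg.2 hlll), mul_pos hδ0 hδ0]
  have hcoef' : (1 - δ) ^ 3 ≤ 1 - δ := by nlinarith [mul_pos hδ0 hδ0]
  have hkx : 0 ≤ k * x := by positivity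
  calc (1 - 25 * (lam / Real.log n)) * (k * x + n * meanExcess μ x)
      ≤ (1 - δ) ^ 3 * (k * x + n * meanExcess μ x) :=
        mul_le_mul_of_nonneg_right hcoef (by positivity)
    _ = (1 - δ) ^ 3 * (k * x) + (1 - δ) ^ 2 * (n * ((1 - δ) * meanExcess μ x)) := by ring
    _ ≤ _ := by gcongr

end Comparison

end PostedPrice

theorem mainTheorem4 :
    ∃ C : ℝ, 0 < C ∧ ∃ N : ℕ, ∀ n : ℕ, N ≤ n → ∀ (m : ℕ) (μ : Measure ℝ) [IsProbabilityMeasure μ],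
      PostedPrice.IsMHR μ →
      ∀ α : Fin m → ℝ, (∀ j, 0 ≤ α j) → Antitone α →
      ∀ a : (Fin n → ℝ) → Fin n → Option (Fin m),
        (∀ t, PostedPrice.IsOutcome (PostedPrice.separableValue α t)
          (PostedPrice.staticPrice n μ α) (a t)) →
        Integrable (fun t => PostedPrice.optWelfare (PostedPrice.separableValue α t))
          (Measure.pi fun _ : Fin n => μ) ∧
        Integrable (fun t => PostedPrice.welfare (PostedPrice.separableValue α t) (a t))
          (Measure.pi fun _ : Fin n => μ) ∧
        (1 - C * (Real.log (Real.log (Real.log n)) / Real.log n)) *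
            ∫ t, PostedPrice.optWelfare (PostedPrice.separableValue α t)
              ∂(Measure.pi fun _ : Fin n => μ) ≤
          ∫ t, PostedPrice.welfare (PostedPrice.separableValue α t) (a t)
            ∂(Measure.pi fun _ : Fin n => μ) := by
  obtain ⟨N, hN⟩ := PostedPrice.eventually_isLarge
  refine ⟨26, by norm_num, N, fun n hn m μ _ hμ α hα hanti a ha => ?_⟩
  have h := hN n hn
  have hK := h.one_le_keptCount
  have := hμ.nullSingletonClass
  have hOPT := PostedPrice.integrable_optWelfare hμ hα hanti hK
  refine ⟨hOPT, PostedPrice.integrable_welfare hμ hα hanti hK ha, ?_⟩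
  set M := min m (PostedPrice.keptCount n)
  set c := PostedPrice.multDrop n α
  set x := PostedPrice.breakpoint n μ
  set w := PostedPrice.window n
  set δ := 1 / Real.log n with hδ
  set lam := Real.log (Real.log (Real.log n))
  have hMK : M ≤ PostedPrice.keptCount n := min_le_right _ _
  have hnpos := h.pos
  have h2 := h.two_le_log
  have hlll : 1 ≤ lam := h.one_le_logloglog
  have hδ0 : 0 < δ := by positivity
  have hδ1 : δ ≤ 1 / 2 := one_div_le_one_div_of_le (by norm_num) h2
  have hc : ∀ k, 1 ≤ k → 0 ≤ c k := fun k hk => PostedPrice.multDrop_nonneg hα hanti hk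
  have hT : ∀ k, w < k → k ≤ M → 0 ≤ PostedPrice.truncExcess μ (x k) (x (k - w)) :=
    fun k h1 h2 => PostedPrice.truncExcess_nonneg
      (h.breakpoint_anti (by omega) (by omega) (h2.trans hMK))
  -- the share of the first `k` items in the welfare of the mechanism and in the optimum
  have hshare : ∀ k, ∃ y, 0 ≤ y ∧ (1 ≤ k → k ≤ M →
      (1 - 25 * (lam / Real.log n)) * (k * y + n * PostedPrice.meanExcess μ y) ≤
      (1 - δ) * (k * x k) +
        (1 - δ) ^ 2 * if w < k then n * PostedPrice.truncExcess μ (x k) (x (k - w)) else 0) := by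
    intro k
    by_cases hk : 1 ≤ k ∧ k ≤ M
    · rcases lt_or_ge (k : ℝ) ((n : ℝ) ^ (7 / 8 : ℝ)) with hlt | hge
      · obtain ⟨y, hy0, hy⟩ := h.exists_le_revenue hμ hk.1 (hk.2.trans hMK) hlt
        refine ⟨y, hy0, fun _ _ => hy.trans (le_add_of_nonneg_right (mul_nonneg (sq_nonneg _) ?_))⟩
        split_ifs with hwk
        · exact mul_nonneg hnpos.le (hT k hwk hk.2)
        · exact le_rfl
      · obtain ⟨hwk, hle⟩ := h.le_revenue_add_utility hμ (hk.2.trans hMK) hge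
        exact ⟨x k, (h.breakpoint_pos (μ := μ) hμ.nonneg hk.1 (hk.2.trans hMK)).le,
          fun _ _ => by rwa [if_pos hwk]⟩
    · exact ⟨0, le_rfl, fun h1 h2 => absurd ⟨h1, h2⟩ hk⟩
  choose y hy0 hy using hshare
  set B := ∑ k ∈ Finset.Icc 1 M, c k * (k * y k + n * PostedPrice.meanExcess μ (y k)) with hB
  have hupper := PostedPrice.integral_optWelfare_le hμ hα hanti hK hy0
  have hlower := h.le_integral_welfare hμ hα hanti ha
  have hmid : (1 - 25 * (lam / Real.log n)) * B ≤
      ∫ t, PostedPrice.welfare (PostedPrice.separableValue α t) (a t)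
        ∂(Measure.pi fun _ : Fin n => μ) := by
    refine le_trans ?_ hlower
    have hsub : ∑ k ∈ Finset.Ioc w M, c k * PostedPrice.truncExcess μ (x k) (x (k - w)) =
        ∑ k ∈ Finset.Icc 1 M,
          if w < k then c k * PostedPrice.truncExcess μ (x k) (x (k - w)) else 0 := by
      rw [← Finset.sum_filter]
      congr 1
      ext k
      simp only [Finset.mem_filter, Finset.mem_Ioc, Finset.mem_Icc]
      omega
    rw [hsub, hB, Finset.mul_sum, Finset.mul_sum, Finset.mul_sum, Finset.mul_sum,
      ← Finset.sum_add_distrib]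
    refine Finset.sum_le_sum fun k hk => ?_
    rw [Finset.mem_Icc] at hk
    have := mul_le_mul_of_nonneg_left (hy k hk.1 hk.2) (hc k hk.1)
    split_ifs at this ⊢ <;> linarith
  have hwel0 : 0 ≤ ∫ t, PostedPrice.welfare (PostedPrice.separableValue α t) (a t)
      ∂(Measure.pi fun _ : Fin n => μ) := by
    refine integral_nonneg_of_ae ?_
    filter_upwards [PostedPrice.ae_nonneg_pi hμ] with t ht
    exact PostedPrice.welfare_nonneg hα ht _
  have hopt0 : 0 ≤ ∫ t, PostedPrice.optWelfare (PostedPrice.separableValue α t)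
      ∂(Measure.pi fun _ : Fin n => μ) := by
    refine integral_nonneg_of_ae ?_
    filter_upwards [PostedPrice.ae_nonneg_pi hμ] with t ht
    exact (PostedPrice.welfare_nonneg hα ht (a t)).trans
      (PostedPrice.welfare_le_optWelfare (ha t).isMatching)
  set OPT := ∫ t, PostedPrice.optWelfare (PostedPrice.separableValue α t)
      ∂(Measure.pi fun _ : Fin n => μ)
  -- discarding the last items costs a factor of at most `1 - δ`
  have hBopt : (1 - δ) * OPT ≤ B := by
    have hKpos : (0 : ℝ) < PostedPrice.keptCount n := by exact_mod_cast hK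
    rw [div_mul_eq_mul_div, le_div_iff₀ hKpos] at hupper
    refine le_of_mul_le_mul_left ?_ hnpos
    calc (n : ℝ) * ((1 - δ) * OPT) = OPT * ((1 - δ) * n) := by ring
      _ ≤ OPT * PostedPrice.keptCount n := mul_le_mul_of_nonneg_left h.le_keptCount hopt0
      _ ≤ n * B := hupper
  have hε : lam / Real.log n = lam * δ := by rw [hδ, mul_one_div]
  rw [hε] at hmid ⊢
  have hlamδ : δ ≤ lam * δ := le_mul_of_one_le_left hδ0.le hlll
  rcases le_or_gt 0 (1 - 25 * (lam * δ)) with hpos | hneg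
  · refine le_trans ?_ (le_trans (mul_le_mul_of_nonneg_left hBopt hpos) hmid)
    rw [← mul_assoc (1 - 25 * (lam * δ))]
    refine mul_le_mul_of_nonneg_right ?_ hopt0
    nlinarith [mul_nonneg (mul_nonneg (by linarith : 0 ≤ lam) hδ0.le) hδ0.le]
  · refine le_trans (mul_nonpos_of_nonpos_of_nonneg ?_ hopt0) hwel0
    linarith
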